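/- **Proposition 4.2 (Strict hinge comparison in the model spaces).** For $K\in\mathbb R$ let $\mathbb L^2(K)$ be the simply connected two-dimensional Lorentzian model space of constant curvature $K$, with signature $(+,-)$: the universal cover of two-dimensional anti-de Sitter space if $K>0$, the Minkowski plane if $K=0$, the universal cover of two-dimensional de Sitter space if $K<0$. Concretely, it is $\mathbb R^2$ with coordinates $(t,x)$, time-oriented by $\partial_t$, and with the metric $$\cosh^2(\sqrt K\,x)\,dt^2-dx^2\ (K>0),\qquad dt^2-dx^2\ (K=0),\qquad dt^2-\cosh^2(\sqrt{-K}\,t)\,dx^2\ (K<0).$$ Let $\ell(x,y)\in[0,\infty]$ be its time separation function, i.e. the supremum of the Lorentzian lengths of the piecewise $C^1$ future-directed causal curves from $x$ to $y$ ($0$ if there are none), let $x\ll y$ mean that there is a future-directed timelike curve from $x$ to $y$, and put $D_K=\pi/\sqrt K$ if $K>0$ and $D_K=+\infty$ if $K\le 0$. A timelike hinge $(x,p,y)$ with $p\ll x$ and $p\ll y$ consists of two future-directed timelike maximising geodesics $[p,x]$, $[p,y]$ (i.e. of lengths $\ell(p,x)$ and $\ell(p,y)$) and of the hyperbolic angle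 $\angle_p(x,y)=\operatorname{arcosh}\frac{g(u,v)}{\sqrt{g(u,u)}\sqrt{g(v,v)}}$ between their initial tangent vectors $u,v$ at $p$. A comparison hinge for it in $\mathbb L^2(K')$ is a hinge $(\bar x,\bar p,\bar y)$ of the same kind in $\mathbb L^2(K')$ with $\ell(\bar p,\bar x)=\ell(p,x)$, $\ell(\bar p,\bar y)=\ell(p,y)$ and $\angle_{\bar p}(\bar x,\bar y)=\angle_p(x,y)$. Let $K<K'$ and let $(x,p,y)$ be a timelike hinge in $\mathbb L^2(K)$ with $p\ll x\ll y$, $\ell(p,y)<D_{K'}$ and $\angle_p(x,y)>0$. Let $(\bar x,\bar p,\bar y)$ be a comparison hinge in $\mathbb L^2(K')$. Then $$\ell(\bar x,\bar y)>\ell(x,y).$$ -/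

import Mathlib

/-!
The Lorentzian model plane `𝕃²(K)`, its time separation function, maximising timelike geodesics,
hyperbolic angles and hinges.

`𝕃²(K)` is realised on `ℝ × ℝ`, with global coordinates `(t, x)`, by the metric
* `cosh² (√K x) dt² - dx²` if `K > 0` (universal cover of two-dimensional anti-de Sitter space),
* `dt² - dx²` if `K = 0` (the Minkowski plane),
* `dt² - cosh² (√(-K) t) dx²` if `K < 0` (universal cover of two-dimensional de Sitter space),
of signature `(+, -)`, and time-oriented by `∂ₜ`.
-/

namespace LorentzModel

noncomputable section

/-- The metric tensor of `𝕃²(K)` at the point `p = (t, x)`. One formula covers the three cases,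
because `Real.sqrt` vanishes on negative numbers: `√K = 0` for `K ≤ 0` and `√(-K) = 0` for `K ≥ 0`.

For `K > 0` and `k = √K` this is the pullback of `dX² + dY² - dZ²` under the covering
`(t, x) ↦ (cosh (k x) cos (k t), cosh (k x) sin (k t), sinh (k x)) / k`
of the quadric `X² + Y² - Z² = 1 / K`. For `K < 0` and `k = √(-K)` it is the pullback of
`dX² - dY² - dZ²` under the covering
`(t, x) ↦ (sinh (k t), cosh (k t) cos (k x), cosh (k t) sin (k x)) / k`
of the quadric `X² - Y² - Z² = 1 / K`. The sectional curvature is constant and equal to `K`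
(in signature `(+, -)`; de Sitter space has negative curvature in this convention). -/
def metric (K : ℝ) (p v w : ℝ × ℝ) : ℝ :=
  Real.cosh (Real.sqrt K * p.2) ^ 2 * (v.1 * w.1)
    - Real.cosh (Real.sqrt (-K) * p.1) ^ 2 * (v.2 * w.2)

/-- `v`, a tangent vector at `p`, is future-directed with respect to the time orientation `∂ₜ`. -/
def IsFuture (K : ℝ) (p v : ℝ × ℝ) : Prop := 0 ≤ metric K p v (1, 0)

/-- `v`, a tangent vector at `p`, is future-directed and causal (timelike or null). -/
def IsFutureCausal (K : ℝ) (p v : ℝ × ℝ) : Prop := 0 ≤ metric K p v v ∧ IsFuture K p v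

/-- `v`, a tangent vector at `p`, is future-directed and timelike. -/
def IsFutureTimelike (K : ℝ) (p v : ℝ × ℝ) : Prop := 0 < metric K p v v ∧ IsFuture K p v

open Classical in
/-- The hyperbolic norm: `√(g(v, v))` on future-directed causal vectors and `0` elsewhere. -/
def hnorm (K : ℝ) (p v : ℝ × ℝ) : ℝ :=
  if IsFutureCausal K p v then Real.sqrt (metric K p v v) else 0

/-- `γ : [0, 1] → ℝ × ℝ` is a piecewise `C¹` curve from `x` to `y` all of whose tangent vectors
(both one-sided ones at a break point) satisfy `C`. Only the values of `γ` on `[0, 1]` matter. -/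
def IsCurveOfType (C : ℝ × ℝ → ℝ × ℝ → Prop) (x y : ℝ × ℝ) (γ : ℝ → ℝ × ℝ) : Prop :=
  γ 0 = x ∧ γ 1 = y ∧
    ∃ (n : ℕ) (τ : ℕ → ℝ), τ 0 = 0 ∧ τ n = 1 ∧ (∀ i < n, τ i < τ (i + 1)) ∧
      ∀ i < n, ContDiffOn ℝ 1 γ (Set.Icc (τ i) (τ (i + 1))) ∧
        ∀ s ∈ Set.Icc (τ i) (τ (i + 1)),
          C (γ s) (derivWithin γ (Set.Icc (τ i) (τ (i + 1))) s)

/-- Future-directed causal piecewise `C¹` curves from `x` to `y` in `𝕃²(K)`. -/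
def IsCausalCurve (K : ℝ) (x y : ℝ × ℝ) (γ : ℝ → ℝ × ℝ) : Prop :=
  IsCurveOfType (IsFutureCausal K) x y γ

/-- Future-directed timelike piecewise `C¹` curves from `x` to `y` in `𝕃²(K)`. -/
def IsTimelikeCurve (K : ℝ) (x y : ℝ × ℝ) (γ : ℝ → ℝ × ℝ) : Prop :=
  IsCurveOfType (IsFutureTimelike K) x y γ

/-- The timelike relation `x ≪ y` of `𝕃²(K)`. -/
def Chron (K : ℝ) (x y : ℝ × ℝ) : Prop := ∃ γ, IsTimelikeCurve K x y γ

/-- The Lorentzian length of a curve `γ : [0, 1] → 𝕃²(K)`. -/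
def length (K : ℝ) (γ : ℝ → ℝ × ℝ) : ℝ := ∫ s in (0 : ℝ)..1, hnorm K (γ s) (deriv γ s)

/-- The time separation function `ℓ` of `𝕃²(K)`, with values in `[0, ∞]`: the supremum of the
lengths of the future-directed causal curves from `x` to `y`, and `0` if there are none. -/
def ell (K : ℝ) (x y : ℝ × ℝ) : ENNReal :=
  ⨆ (γ : ℝ → ℝ × ℝ) (_ : IsCausalCurve K x y γ), ENNReal.ofReal (length K γ)

/-- The constant `D_K`: `π / √K` if `K > 0`, and `∞` if `K ≤ 0`. -/
def diam (K : ℝ) : ENNReal :=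
  if 0 < K then ENNReal.ofReal (Real.pi / Real.sqrt K) else ⊤

/-- `γ : [0, 1] → 𝕃²(K)` is a (future-directed) timelike maximising geodesic `[p, q]`: a regularly
parametrised `C¹` timelike curve from `p` to `q` whose length is `ℓ(p, q)`. No particular
parametrisation is prescribed. -/
structure IsMaxGeodesic (K : ℝ) (p q : ℝ × ℝ) (γ : ℝ → ℝ × ℝ) : Prop where
  source : γ 0 = p
  target : γ 1 = q
  contDiffOn : ContDiffOn ℝ 1 γ (Set.Icc 0 1)
  timelike : ∀ s ∈ Set.Icc (0 : ℝ) 1, IsFutureTimelike K (γ s) (derivWithin γ (Set.Icc 0 1) s)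
  maximising : ENNReal.ofReal (length K γ) = ell K p q

/-- The hyperbolic angle between two future-directed timelike tangent vectors at `p`. -/
def vecAngle (K : ℝ) (p u v : ℝ × ℝ) : ℝ :=
  Real.arcosh (metric K p u v / (hnorm K p u * hnorm K p v))

/-- A timelike hinge `(x, p, y)` in `𝕃²(K)` with `p ≪ x` and `p ≪ y`: two timelike maximising
geodesics `[p, x]` and `[p, y]` emanating from the vertex `p`. -/
structure Hinge (K : ℝ) where
  x : ℝ × ℝ
  p : ℝ × ℝ
  y : ℝ × ℝ
  sideX : ℝ → ℝ × ℝ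
  sideY : ℝ → ℝ × ℝ
  isMaxGeodesic_sideX : IsMaxGeodesic K p x sideX
  isMaxGeodesic_sideY : IsMaxGeodesic K p y sideY

/-- The angle `∠ₚ(x, y)` of a hinge: the hyperbolic angle between the initial tangent vectors of its
two sides. -/
def Hinge.angle {K : ℝ} (H : Hinge K) : ℝ :=
  vecAngle K H.p (derivWithin H.sideX (Set.Icc 0 1) 0) (derivWithin H.sideY (Set.Icc 0 1) 0)

/-- `H'`, a hinge in `𝕃²(K')`, is a comparison hinge for `H`: corresponding sides have equal lengths,
and the angles are equal. (In both hinges the two sides are future-directed.) -/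
structure IsComparisonHinge {K K' : ℝ} (H : Hinge K) (H' : Hinge K') : Prop where
  ell_px : ell K' H'.p H'.x = ell K H.p H.x
  ell_py : ell K' H'.p H'.y = ell K H.p H.y
  angle_eq : H'.angle = H.angle

end

end LorentzModel

/-! In geodesic polar coordinates about the vertex, with `r` the time separation from `p` and `θ`
the hyperbolic angle, the model metric is `dr² - sn_K(r)² dθ²`. Sturm comparison gives `sn_{K'} <
sn_K` for `K < K'` below the diameter bound (`sn_lt_sn`). Carrying a point to the point of `𝕃²(K')`
with the same polar coordinates therefore keeps `dr` and shrinks the negative angular term. Causal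
vectors stay causal and their norms do not decrease. Up to an isometry `θ ↦ ±θ + τ`, this map
`polarMap` takes `x, y` to the endpoints of the comparison hinge, because maximising geodesics from
`p` are radial (`of_isMaxGeodesic`) and the hinge angle is the difference of the angular coordinates
(`vecAngle_eq`).

Applied to every causal curve from `x` to `y`, this gives `≤`. Strictness has to survive the
supremum, which is not known to be attained, so a gain independent of the curve is needed. On the
compact range of radii involved, `sn_K² - sn_{K'}² ≥ m > 0`. Completing a square bounds the gain in
norm below by an exact differential `dΨ`, linear in `dr` and `dθ` (`hnorm_add_le_hnorm_polarMap`).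
Integrated along any curve, `dΨ` gives `Ψ y - Ψ x`, which depends only on the endpoints and is
positive when their angles differ (`ell_lt_ell_polarMap`).

The argument needs causal curves from `x` to `y` to remain inside the polar domain. They can leave
it only at radius `D_K` or beyond, which `ℓ(p, y) < D_K` forbids (`mem_of_ell_lt`). The three
curvature signs enter only through the construction of a `PolarChart`. -/

open Filter Topology MeasureTheory

namespace LorentzModel
noncomputable section

/-! ### Generalised trigonometric functions and Sturm comparison -/

/-- The generalised sine: the solution of `f'' + K f = 0` with `f 0 = 0` and `f' 0 = 1`. -/
def sn (K r : ℝ) : ℝ :=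
  if 0 < K then Real.sin (√K * r) / √K else if K < 0 then Real.sinh (√(-K) * r) / √(-K) else r

/-- The generalised cosine, the derivative of `sn K`. -/
def cs (K r : ℝ) : ℝ :=
  if 0 < K then Real.cos (√K * r) else if K < 0 then Real.cosh (√(-K) * r) else 1

/-- The modified distance, the primitive of `sn K` that vanishes at `0`. -/
def md (K r : ℝ) : ℝ :=
  if 0 < K then (1 - Real.cos (√K * r)) / K
  else if K < 0 then (1 - Real.cosh (√(-K) * r)) / K else r ^ 2 / 2

/-- The inverse of `md K`. -/
def rad (K h : ℝ) : ℝ :=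
  if 0 < K then Real.arccos (1 - K * h) / √K
  else if K < 0 then 2 * Real.arsinh (√(-K * h / 2)) / √(-K) else √(2 * h)

/-- `r` lies below the diameter bound `D_K`. -/
def BelowDiam (K r : ℝ) : Prop := 0 < K → √K * r < Real.pi

lemma hasDerivAt_md (K r : ℝ) : HasDerivAt (md K) (sn K r) r := by
  unfold md sn
  rcases lt_trichotomy 0 K with h | h | h
  · simp only [h, if_true]
    have h1 : HasDerivAt (fun r => √K * r) (√K * 1) r := (hasDerivAt_id r).const_mul _
    refine ((h1.cos.const_sub 1).div_const K).congr_deriv ?_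
    have : √K ≠ 0 := (Real.sqrt_pos.2 h).ne'
    have h2 : √K * √K = K := Real.mul_self_sqrt h.le
    rw [div_eq_div_iff h.ne' this]; linear_combination Real.sin (√K * r) * h2
  · subst h
    simp only [lt_irrefl, if_false]
    exact (((hasDerivAt_id r).pow 2).div_const 2).congr_deriv (by simp)
  · simp only [h, h.not_gt, if_true, if_false]
    have h1 : HasDerivAt (fun r => √(-K) * r) (√(-K) * 1) r := (hasDerivAt_id r).const_mul _
    refine ((h1.cosh.const_sub 1).div_const K).congr_deriv ?_
    have : √(-K) ≠ 0 := (Real.sqrt_pos.2 (by linarith)).ne'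
    have h2 : √(-K) * √(-K) = -K := Real.mul_self_sqrt (by linarith)
    rw [div_eq_div_iff h.ne this]
    linear_combination (-Real.sinh (√(-K) * r)) * h2

lemma hasDerivAt_sn (K r : ℝ) : HasDerivAt (sn K) (cs K r) r := by
  unfold cs sn
  rcases lt_trichotomy 0 K with h | h | h
  · simp only [h, if_true]
    have h1 : HasDerivAt (fun r => √K * r) (√K * 1) r := (hasDerivAt_id r).const_mul _
    refine (h1.sin.div_const (√K)).congr_deriv ?_
    have : √K ≠ 0 := (Real.sqrt_pos.2 h).ne'
    field_simp
  · subst h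
    simp only [lt_irrefl, if_false]
    exact hasDerivAt_id r
  · simp only [h, h.not_gt, if_true, if_false]
    have h1 : HasDerivAt (fun r => √(-K) * r) (√(-K) * 1) r := (hasDerivAt_id r).const_mul _
    refine (h1.sinh.div_const (√(-K))).congr_deriv ?_
    have : √(-K) ≠ 0 := (Real.sqrt_pos.2 (by linarith)).ne'
    field_simp

lemma hasDerivAt_cs (K r : ℝ) : HasDerivAt (cs K) (-K * sn K r) r := by
  unfold cs sn
  rcases lt_trichotomy 0 K with h | h | h
  · simp only [h, if_true]
    have h1 : HasDerivAt (fun r => √K * r) (√K * 1) r := (hasDerivAt_id r).const_mul _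
    refine h1.cos.congr_deriv ?_
    have : √K ≠ 0 := (Real.sqrt_pos.2 h).ne'
    have h2 : √K ^ 2 = K := Real.sq_sqrt h.le
    field_simp
    rw [h2]
    ring
  · subst h
    simp only [lt_irrefl, if_false]
    simpa using hasDerivAt_const r (1 : ℝ)
  · simp only [h, h.not_gt, if_true, if_false]
    have h1 : HasDerivAt (fun r => √(-K) * r) (√(-K) * 1) r := (hasDerivAt_id r).const_mul _
    refine h1.cosh.congr_deriv ?_
    have : √(-K) ≠ 0 := (Real.sqrt_pos.2 (by linarith)).ne'
    have h2 : √(-K) ^ 2 = -K := Real.sq_sqrt (by linarith)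
    field_simp
    rw [h2]
    ring

lemma contDiff_sn (K : ℝ) : ContDiff ℝ 1 (sn K) := by
  unfold sn; split_ifs <;> fun_prop

lemma contDiff_md (K : ℝ) : ContDiff ℝ 1 (md K) := by
  unfold md; split_ifs <;> fun_prop

lemma sn_zero (K : ℝ) : sn K 0 = 0 := by simp [sn]

lemma cs_zero (K : ℝ) : cs K 0 = 1 := by simp [cs]

lemma md_zero (K : ℝ) : md K 0 = 0 := by simp [md]

/-- This is `cs² + K sn² = 1` with `cs = 1 - K md`. Written through `md` alone it becomes polynomial
in the smooth function `h` of a polar chart. -/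
lemma sn_sq (K r : ℝ) : sn K r ^ 2 = md K r * (2 - K * md K r) := by
  unfold md sn
  rcases lt_trichotomy 0 K with h | h | h
  · simp only [h, if_true]
    have : √K ≠ 0 := (Real.sqrt_pos.2 h).ne'
    rw [div_pow, Real.sq_sqrt h.le, Real.sin_sq]
    field_simp
    ring
  · subst h
    simp only [lt_irrefl, if_false]
    ring
  · simp only [h, h.not_gt, if_true, if_false]
    rw [div_pow, Real.sq_sqrt (by linarith), Real.sinh_sq]
    have := h.ne
    field_simp
    ring

lemma sn_pos {K r : ℝ} (hr : 0 < r) (hD : BelowDiam K r) : 0 < sn K r := by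
  unfold sn
  split_ifs with h h'
  · have := Real.sqrt_pos.2 h
    exact div_pos (Real.sin_pos_of_pos_of_lt_pi (by positivity) (hD h)) this
  · have : 0 < √(-K) := Real.sqrt_pos.2 (by linarith)
    exact div_pos (Real.sinh_pos_iff.2 (by positivity)) this
  · exact hr

lemma sn_nonneg {K r : ℝ} (hr : 0 ≤ r) (hD : BelowDiam K r) : 0 ≤ sn K r := by
  rcases hr.eq_or_lt with rfl | hr
  · rw [sn_zero]
  · exact (sn_pos hr hD).le

lemma md_pos {K r : ℝ} (hr : 0 < r) (hD : BelowDiam K r) : 0 < md K r := by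
  unfold md
  split_ifs with h h'
  · have := Real.sqrt_pos.2 h
    have hc : Real.cos (√K * r) < Real.cos 0 :=
      Real.cos_lt_cos_of_nonneg_of_le_pi le_rfl (hD h).le (by positivity)
    rw [Real.cos_zero] at hc
    exact div_pos (by linarith) h
  · have : 0 < √(-K) := Real.sqrt_pos.2 (by linarith)
    have hc : 1 < Real.cosh (√(-K) * r) := Real.one_lt_cosh.2 (by positivity)
    exact div_pos_of_neg_of_neg (by linarith) h'
  · positivity

lemma md_nonneg {K r : ℝ} (hr : 0 ≤ r) (hD : BelowDiam K r) : 0 ≤ md K r := by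
  rcases hr.eq_or_lt with rfl | hr
  · rw [md_zero]
  · exact (md_pos hr hD).le

lemma mul_md_lt_two {K r : ℝ} (hr : 0 ≤ r) (hD : BelowDiam K r) : K * md K r < 2 := by
  unfold md
  split_ifs with h h'
  · have := Real.sqrt_pos.2 h
    have hc : Real.cos Real.pi < Real.cos (√K * r) :=
      Real.cos_lt_cos_of_nonneg_of_le_pi (by positivity) le_rfl (hD h)
    rw [Real.cos_pi] at hc
    rw [mul_div_cancel₀ _ h.ne']; linarith
  · rw [mul_div_cancel₀ _ h'.ne]
    linarith [Real.cosh_pos (√(-K) * r)]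
  · have : K = 0 := le_antisymm (not_lt.1 h) (not_lt.1 h')
    simp [this]

lemma rad_md {K r : ℝ} (hr : 0 ≤ r) (hD : BelowDiam K r) : rad K (md K r) = r := by
  unfold md rad
  split_ifs with h h'
  · have := Real.sqrt_pos.2 h
    rw [mul_div_cancel₀ _ h.ne', sub_sub_cancel, Real.arccos_cos (by positivity) (hD h).le,
      mul_div_cancel_left₀ _ this.ne']
  · have hk : 0 < √(-K) := Real.sqrt_pos.2 (by linarith)
    have e : -K * ((1 - Real.cosh (√(-K) * r)) / K) / 2 = Real.sinh (√(-K) * r / 2) ^ 2 := by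
      have h2 := Real.cosh_two_mul (√(-K) * r / 2)
      have h3 := Real.cosh_sq (√(-K) * r / 2)
      rw [mul_div_cancel₀ (√(-K) * r) two_ne_zero] at h2
      have := h'.ne
      field_simp
      linarith
    rw [e, Real.sqrt_sq (Real.sinh_nonneg_iff.2 (by positivity)), Real.arsinh_sinh]
    field_simp
  · rw [mul_div_cancel₀ _ two_ne_zero, Real.sqrt_sq hr]

lemma md_rad {K h : ℝ} (hh : 0 ≤ h) (hK : K * h ≤ 2) : md K (rad K h) = h := by
  unfold md rad
  split_ifs with h1 h2
  · have := Real.sqrt_pos.2 h1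
    rw [mul_div_cancel₀ _ this.ne', Real.cos_arccos (by linarith) (by nlinarith)]
    field_simp
    ring
  · have hk : 0 < √(-K) := Real.sqrt_pos.2 (by linarith)
    have h3 : 0 ≤ -K * h / 2 := by nlinarith
    rw [mul_div_cancel₀ _ hk.ne', Real.cosh_two_mul, Real.cosh_sq, Real.sinh_arsinh,
      Real.sq_sqrt h3]
    have := h2.ne
    field_simp
    ring
  · rw [Real.sq_sqrt (by positivity)]; ring

lemma rad_zero (K : ℝ) : rad K 0 = 0 := by simp [rad]

lemma rad_pos {K h : ℝ} (hh : 0 < h) : 0 < rad K h := by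
  unfold rad
  split_ifs with h1 h2
  · exact div_pos (Real.arccos_pos.2 (by nlinarith)) (Real.sqrt_pos.2 h1)
  · have hk : 0 < √(-K) := Real.sqrt_pos.2 (by linarith)
    have h3 : 0 < -K * h / 2 := by nlinarith
    have := Real.arsinh_pos_iff.2 (Real.sqrt_pos.2 h3)
    positivity
  · positivity

lemma belowDiam_rad {K h : ℝ} (hK : K * h < 2) : BelowDiam K (rad K h) := by
  intro h1
  have := Real.sqrt_pos.2 h1
  rw [rad, if_pos h1, mul_div_cancel₀ _ this.ne']
  refine lt_of_le_of_ne (Real.arccos_le_pi _) fun h => ?_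
  rw [Real.arccos_eq_pi] at h
  linarith

/-- `Real.arccos` is constantly `π` on arguments at most `-1`, so `rad` saturates at exactly `D_K`.
This is what makes reaching `K h ≥ 2` contradict a bound by the diameter. -/
lemma not_belowDiam_rad {K h : ℝ} (hh : 0 < h) (hK : 2 ≤ K * h) : ¬ BelowDiam K (rad K h) := by
  have h1 : 0 < K := by by_contra h1; nlinarith
  intro hD
  have := Real.sqrt_pos.2 h1
  have h2 := hD h1
  rw [rad, if_pos h1, mul_div_cancel₀ _ this.ne', Real.arccos_of_le_neg_one (by linarith)] at h2
  exact lt_irrefl _ h2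

lemma continuous_rad (K : ℝ) : Continuous (rad K) := by
  unfold rad
  split_ifs
  · have := Real.continuous_arccos
    fun_prop
  · have := Real.continuous_arsinh
    fun_prop
  · fun_prop

/-- The value `h = 0` is excluded because `rad` behaves like a square root there: the radial
coordinate is only continuous at the vertex. -/
lemma contDiffAt_rad {K h : ℝ} (hh : 0 < h) (hK : K * h < 2) : ContDiffAt ℝ 1 (rad K) h := by
  unfold rad
  split_ifs with h1 h2
  · have h3 : ContDiffAt ℝ 1 Real.arccos (1 - K * h) :=
      Real.contDiffAt_arccos (by linarith) (by nlinarith)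
    exact (h3.comp h (f := fun h => 1 - K * h) (by fun_prop)).div_const _
  · have h3 : 0 < -K * h / 2 := by nlinarith
    have h4 : ContDiffAt ℝ 1 (fun h => √(-K * h / 2)) h :=
      ContDiffAt.sqrt (by fun_prop) h3.ne'
    exact (contDiffAt_const.mul h4.arsinh).div_const _
  · exact ContDiffAt.sqrt (by fun_prop) (by positivity)

lemma BelowDiam.mono {K r s : ℝ} (h : BelowDiam K s) (hrs : r ≤ s) : BelowDiam K r := fun hK =>
  (mul_le_mul_of_nonneg_left hrs (Real.sqrt_nonneg K)).trans_lt (h hK)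

lemma BelowDiam.of_le {K K' r : ℝ} (h : BelowDiam K' r) (hr : 0 ≤ r) (hK : K ≤ K') :
    BelowDiam K r := fun h0 =>
  (mul_le_mul_of_nonneg_right (Real.sqrt_le_sqrt hK) hr).trans_lt (h (h0.trans_le hK))

lemma isOpen_belowDiam (K : ℝ) : IsOpen {r | BelowDiam K r} := by
  by_cases hK : 0 < K
  · simp only [BelowDiam, hK, true_imp_iff]
    exact isOpen_lt (by fun_prop) (by fun_prop)
  · simp [BelowDiam, hK]

lemma ofReal_lt_diam {K r : ℝ} : ENNReal.ofReal r < diam K ↔ BelowDiam K r := by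
  unfold diam BelowDiam
  split_ifs with h
  · have := Real.sqrt_pos.2 h
    rw [ENNReal.ofReal_lt_ofReal_iff (by positivity), lt_div_iff₀ this, mul_comm]
    simp [h]
  · simp [h]

/-- Sturm comparison. -/
lemma sn_lt_sn {K K' r : ℝ} (hK : K < K') (hr : 0 < r) (hD : BelowDiam K' r) :
    sn K' r < sn K r := by
  have hD0 : ∀ t, t ≤ r → BelowDiam K' t := fun t ht => hD.mono ht
  have hpos' : ∀ t, 0 < t → t ≤ r → 0 < sn K' t := fun t h0 h1 => sn_pos h0 (hD0 t h1)
  have hpos : ∀ t, 0 < t → t ≤ r → 0 < sn K t := fun t h0 h1 =>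
    sn_pos h0 ((hD0 t h1).of_le h0.le hK.le)
  have hc : ∀ K, Continuous (sn K) := fun K => (contDiff_sn K).continuous
  have hcc : ∀ K, Continuous (cs K) := fun K =>
    continuous_iff_continuousAt.2 fun t => (hasDerivAt_cs K t).continuousAt
  -- the Wronskian is positive
  have hW : StrictMonoOn (fun t => cs K t * sn K' t - sn K t * cs K' t) (Set.Icc 0 r) := by
    refine strictMonoOn_of_deriv_pos (convex_Icc 0 r)
      (((hcc K).mul (hc K')).sub ((hc K).mul (hcc K'))).continuousOn fun t ht => ?_
    rw [interior_Icc] at ht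
    have h := ((hasDerivAt_cs K t).mul (hasDerivAt_sn K' t)).sub
      ((hasDerivAt_sn K t).mul (hasDerivAt_cs K' t))
    have h2 := h.deriv
    rw [show (fun t => cs K t * sn K' t - sn K t * cs K' t)
      = cs K * sn K' - sn K * cs K' from rfl, h2]
    have := mul_pos (sub_pos.2 hK) (mul_pos (hpos t ht.1 ht.2.le) (hpos' t ht.1 ht.2.le))
    linarith
  have hW0 : ∀ t, 0 < t → t ≤ r → 0 < cs K t * sn K' t - sn K t * cs K' t := fun t h0 h1 => by
    have := hW (Set.left_mem_Icc.2 hr.le) ⟨h0.le, h1⟩ h0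
    simpa [sn_zero] using this
  -- The derivative of the quotient is the Wronskian over `sn K' ^ 2`. As the quotient tends to `1`
  -- at `0`, it exceeds `1` afterwards.
  have hQ : StrictMonoOn (fun t => sn K t / sn K' t) (Set.Ioc 0 r) := by
    refine strictMonoOn_of_deriv_pos (convex_Ioc 0 r) ?_ fun t ht => ?_
    · exact (hc K).continuousOn.div (hc K').continuousOn fun t ht => (hpos' t ht.1 ht.2).ne'
    · rw [interior_Ioc] at ht
      have h := (hasDerivAt_sn K t).div (hasDerivAt_sn K' t) (hpos' t ht.1 ht.2.le).ne'
      rw [show (fun t => sn K t / sn K' t) = sn K / sn K' from rfl, h.deriv]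
      exact div_pos (hW0 t ht.1 ht.2.le) (pow_pos (hpos' t ht.1 ht.2.le) 2)
  have hlim : ∀ K, Tendsto (fun t => sn K t / t) (𝓝[>] 0) (𝓝 1) := fun K => by
    have h := (hasDerivAt_sn K 0).tendsto_slope
    rw [cs_zero] at h
    refine (h.mono_left (nhdsWithin_mono 0 fun t ht => ne_of_gt ht)).congr fun t => ?_
    simp [slope, sn_zero, div_eq_inv_mul]
  have hQlim : Tendsto (fun t => sn K t / sn K' t) (𝓝[>] 0) (𝓝 1) := by
    have h := (hlim K).div (hlim K') one_ne_zero
    rw [div_one] at h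
    refine h.congr' ?_
    filter_upwards [self_mem_nhdsWithin] with t ht
    exact div_div_div_cancel_right₀ (ne_of_gt ht) _ _
  -- The limit at `0` yields only a weak inequality; strictness comes from monotonicity between `r /
  -- 2` and `r`.
  have hhalf : 1 ≤ sn K (r / 2) / sn K' (r / 2) := by
    refine le_of_tendsto hQlim ?_
    filter_upwards [Ioo_mem_nhdsGT (half_pos hr)] with t ht
    exact (hQ ⟨ht.1, by linarith [ht.2]⟩ ⟨by linarith, by linarith⟩ ht.2).le
  have h := hhalf.trans_lt (hQ ⟨half_pos hr, by linarith⟩ ⟨hr, le_rfl⟩ (half_lt_self hr))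
  exact (one_lt_div (hpos' r hr le_rfl)).1 h

/-! ### Causal vectors and their norms -/

lemma metric_neg_neg (K : ℝ) (p v : ℝ × ℝ) : metric K p (-v) (-v) = metric K p v v := by
  simp [metric]

lemma metric_smul_smul (K : ℝ) (p v : ℝ × ℝ) (a : ℝ) :
    metric K p (a • v) (a • v) = a ^ 2 * metric K p v v := by
  simp [metric]; ring

lemma isFuture_iff {K : ℝ} {p v : ℝ × ℝ} : IsFuture K p v ↔ 0 ≤ v.1 := by
  have : 0 < Real.cosh (√K * p.2) ^ 2 := pow_pos (Real.cosh_pos _) 2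
  simp [IsFuture, metric, this]

lemma IsFutureTimelike.causal {K : ℝ} {p v : ℝ × ℝ} (h : IsFutureTimelike K p v) :
    IsFutureCausal K p v := ⟨h.1.le, h.2⟩

lemma IsFutureTimelike.fst_pos {K : ℝ} {p v : ℝ × ℝ} (h : IsFutureTimelike K p v) :
    0 < v.1 := by
  refine lt_of_le_of_ne (isFuture_iff.1 h.2) fun h0 => ?_
  have h1 := h.1
  simp only [metric, ← h0] at h1
  nlinarith [sq_nonneg (Real.cosh (√(-K) * p.1) * v.2)]

lemma IsFutureCausal.hnorm_eq {K : ℝ} {p v : ℝ × ℝ} (h : IsFutureCausal K p v) :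
    hnorm K p v = √(metric K p v v) := if_pos h

lemma hnorm_nonneg (K : ℝ) (p v : ℝ × ℝ) : 0 ≤ hnorm K p v := by
  unfold hnorm; split_ifs <;> positivity

lemma IsFutureCausal.smul {K : ℝ} {p v : ℝ × ℝ} (h : IsFutureCausal K p v) {a : ℝ} (ha : 0 ≤ a) :
    IsFutureCausal K p (a • v) := by
  refine ⟨?_, isFuture_iff.2 ?_⟩
  · rw [metric_smul_smul]; exact mul_nonneg (sq_nonneg a) h.1
  · exact mul_nonneg ha (isFuture_iff.1 h.2)

lemma hnorm_smul (K : ℝ) (p v : ℝ × ℝ) {a : ℝ} (ha : 0 < a) :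
    hnorm K p (a • v) = a * hnorm K p v := by
  have key : IsFutureCausal K p (a • v) ↔ IsFutureCausal K p v := by
    refine ⟨fun h => ?_, fun h => h.smul ha.le⟩
    have := h.smul (inv_nonneg.2 ha.le)
    rwa [smul_smul, inv_mul_cancel₀ ha.ne', one_smul] at this
  by_cases h : IsFutureCausal K p v
  · rw [h.hnorm_eq, (key.2 h).hnorm_eq, metric_smul_smul, Real.sqrt_mul (sq_nonneg a),
      Real.sqrt_sq ha.le]
  · rw [hnorm, hnorm, if_neg h, if_neg (mt key.1 h), mul_zero]

/-! ### Geodesic polar coordinates, abstractly -/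

/-- Functions on `𝕃²(K)` from which geodesic polar coordinates about `p` are built. If `r` is the
distance from `p` and `θ` the hyperbolic angle, then `h = md K r`, `A = sn K r * cosh θ` and
`B = sn K r * sinh θ` on the domain `U` of the polar coordinates; `G` recovers a point from the
values of these functions. -/
structure PolarChart (K : ℝ) (p : ℝ × ℝ) where
  U : Set (ℝ × ℝ)
  h : ℝ × ℝ → ℝ
  A : ℝ × ℝ → ℝ
  B : ℝ × ℝ → ℝ
  G : ℝ × ℝ × ℝ → ℝ × ℝ
  isOpen_U : IsOpen U
  contDiff_h : ContDiff ℝ 1 h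
  contDiff_A : ContDiff ℝ 1 A
  contDiff_B : ContDiff ℝ 1 B
  rel : ∀ q, A q ^ 2 - B q ^ 2 = h q * (2 - K * h q)
  -- The polar form of the metric multiplied by `sn²`; in this form it holds everywhere, including
  -- the light cone of `p`, where the angle is undefined.
  metric_mul : ∀ q v, metric K q v v * (A q ^ 2 - B q ^ 2) =
    (fderiv ℝ h q v) ^ 2 - (A q * fderiv ℝ B q v - B q * fderiv ℝ A q v) ^ 2
  A_pos : ∀ q ∈ U, 0 < A q
  h_pos : ∀ q ∈ U, 0 < h q
  mul_h_lt : ∀ q ∈ U, K * h q < 2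
  fderiv_h_pos : ∀ q ∈ U, 0 < fderiv ℝ h q (1, 0)
  -- The boundary of `U` can be met only where `h ≤ 0` or `K h ≥ 2`.
  mem_of_closure : ∀ q ∈ closure U, 0 < h q → K * h q < 2 → q ∈ U
  eventually_mem : ∀ᶠ q in 𝓝 p, p.1 < q.1 → 0 < h q → q ∈ U
  h_self : h p = 0
  A_self : A p = 0
  B_self : B p = 0
  -- At the vertex `(dA, dB)` is an orthonormal coframe, which converts initial directions into
  -- angles.
  metric_self : ∀ v w, fderiv ℝ A p v * fderiv ℝ A p w - fderiv ℝ B p v * fderiv ℝ B p w =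
    metric K p v w
  fderiv_A_pos : ∀ v : ℝ × ℝ, 0 < v.1 → 0 < fderiv ℝ A p v
  -- The vertex `h = a = b = 0` is included, so that radial curves are `C¹` up to their starting
  -- point.
  contDiffAt_G : ∀ h a b, 0 ≤ h → K * h < 2 → 0 ≤ a → a ^ 2 - b ^ 2 = h * (2 - K * h) →
    ContDiffAt ℝ 1 G (h, a, b)
  G_mem : ∀ h a b, 0 < h → K * h < 2 → 0 < a → a ^ 2 - b ^ 2 = h * (2 - K * h) → G (h, a, b) ∈ U
  h_G : ∀ m a b, 0 < m → K * m < 2 → 0 < a → a ^ 2 - b ^ 2 = m * (2 - K * m) → h (G (m, a, b)) = m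
  A_G : ∀ m a b, 0 < m → K * m < 2 → 0 < a → a ^ 2 - b ^ 2 = m * (2 - K * m) → A (G (m, a, b)) = a
  B_G : ∀ m a b, 0 < m → K * m < 2 → 0 < a → a ^ 2 - b ^ 2 = m * (2 - K * m) → B (G (m, a, b)) = b
  G_apply : ∀ q ∈ U, G (h q, A q, B q) = q
  G_zero : G (0, 0, 0) = p

namespace PolarChart
variable {K : ℝ} {p : ℝ × ℝ} (c : PolarChart K p)

/-- The radial coordinate. -/
def R (q : ℝ × ℝ) : ℝ := rad K (c.h q)

/-- The angular coordinate. -/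
def Θ (q : ℝ × ℝ) : ℝ := Real.arsinh (c.B q / √(c.A q ^ 2 - c.B q ^ 2))

/-- The inverse of the polar coordinates. -/
def E (z : ℝ × ℝ) : ℝ × ℝ := c.G (md K z.1, sn K z.1 * Real.cosh z.2, sn K z.1 * Real.sinh z.2)

variable {q v : ℝ × ℝ}

lemma sq_sub_sq_pos (hq : q ∈ c.U) : 0 < c.A q ^ 2 - c.B q ^ 2 := by
  rw [c.rel]
  exact mul_pos (c.h_pos q hq) (by linarith [c.mul_h_lt q hq])

lemma R_pos (hq : q ∈ c.U) : 0 < c.R q := rad_pos (c.h_pos q hq)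

lemma belowDiam_R (hq : q ∈ c.U) : BelowDiam K (c.R q) := belowDiam_rad (c.mul_h_lt q hq)

lemma md_R (hq : q ∈ c.U) : md K (c.R q) = c.h q :=
  md_rad (c.h_pos q hq).le (c.mul_h_lt q hq).le

lemma sn_R_pos (hq : q ∈ c.U) : 0 < sn K (c.R q) := sn_pos (c.R_pos hq) (c.belowDiam_R hq)

lemma sn_R (hq : q ∈ c.U) : sn K (c.R q) = √(c.A q ^ 2 - c.B q ^ 2) := by
  rw [← Real.sqrt_sq (c.sn_R_pos hq).le, sn_sq, c.md_R hq, c.rel]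

lemma sn_mul_sinh (hq : q ∈ c.U) : sn K (c.R q) * Real.sinh (c.Θ q) = c.B q := by
  rw [Θ, Real.sinh_arsinh, c.sn_R hq, mul_div_cancel₀]
  exact (Real.sqrt_pos.2 (c.sq_sub_sq_pos hq)).ne'

lemma sn_mul_cosh (hq : q ∈ c.U) : sn K (c.R q) * Real.cosh (c.Θ q) = c.A q := by
  have h1 : 0 ≤ sn K (c.R q) * Real.cosh (c.Θ q) :=
    mul_nonneg (c.sn_R_pos hq).le (Real.cosh_pos _).le
  rw [← sq_eq_sq₀ h1 (c.A_pos q hq).le, mul_pow, Real.cosh_sq, mul_add, ← mul_pow,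
    c.sn_mul_sinh hq, sn_sq, c.md_R hq, mul_one, ← c.rel]
  ring

lemma E_R_Θ (hq : q ∈ c.U) : c.E (c.R q, c.Θ q) = q := by
  simp only [E]
  rw [c.md_R hq, c.sn_mul_cosh hq, c.sn_mul_sinh hq, c.G_apply q hq]

lemma E_zero (θ : ℝ) : c.E (0, θ) = p := by
  simp only [E, md_zero, sn_zero, zero_mul, c.G_zero]

lemma contDiffAt_R (hq : q ∈ c.U) : ContDiffAt ℝ 1 c.R q :=
  (contDiffAt_rad (c.h_pos q hq) (c.mul_h_lt q hq)).comp q c.contDiff_h.contDiffAt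

lemma contDiffAt_Θ (hq : q ∈ c.U) : ContDiffAt ℝ 1 c.Θ q := by
  have h1 := c.sq_sub_sq_pos hq
  have hA := c.contDiff_A.contDiffAt (x := q)
  have hB := c.contDiff_B.contDiffAt (x := q)
  exact (hB.div (((hA.pow 2).sub (hB.pow 2)).sqrt h1.ne') (Real.sqrt_pos.2 h1).ne').arsinh

lemma continuous_R : Continuous c.R := (continuous_rad K).comp c.contDiff_h.continuous

lemma R_self : c.R p = 0 := by rw [R, c.h_self, rad_zero]

section
variable {r θ : ℝ}

lemma rel_md_sn (r θ : ℝ) : (sn K r * Real.cosh θ) ^ 2 - (sn K r * Real.sinh θ) ^ 2 =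
    md K r * (2 - K * md K r) := by
  rw [← sn_sq, mul_pow, mul_pow, Real.cosh_sq]; ring

lemma E_mem (hr : 0 < r) (hD : BelowDiam K r) : c.E (r, θ) ∈ c.U :=
  c.G_mem _ _ _ (md_pos hr hD) (mul_md_lt_two hr.le hD)
    (mul_pos (sn_pos hr hD) (Real.cosh_pos θ)) (rel_md_sn r θ)

lemma R_E (hr : 0 < r) (hD : BelowDiam K r) : c.R (c.E (r, θ)) = r := by
  rw [R, E, c.h_G _ _ _ (md_pos hr hD) (mul_md_lt_two hr.le hD)
    (mul_pos (sn_pos hr hD) (Real.cosh_pos θ)) (rel_md_sn r θ), rad_md hr.le hD]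

lemma Θ_E (hr : 0 < r) (hD : BelowDiam K r) : c.Θ (c.E (r, θ)) = θ := by
  have h := c.sn_mul_sinh (c.E_mem (θ := θ) hr hD)
  rw [c.R_E hr hD, E, c.B_G _ _ _ (md_pos hr hD) (mul_md_lt_two hr.le hD)
    (mul_pos (sn_pos hr hD) (Real.cosh_pos θ)) (rel_md_sn r θ)] at h
  exact Real.sinh_injective (mul_left_cancel₀ (sn_pos hr hD).ne' h)

/-- The radius `r = 0` is allowed: the inverse polar map is smooth there although `R` and `Θ` are
not. -/
lemma contDiffAt_E (hr : 0 ≤ r) (hD : BelowDiam K r) : ContDiffAt ℝ 1 c.E (r, θ) := by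
  have h1 := c.contDiffAt_G _ _ _ (md_nonneg hr hD) (mul_md_lt_two hr hD)
    (mul_nonneg (sn_nonneg hr hD) (Real.cosh_pos θ).le) (rel_md_sn r θ)
  have h2 : ContDiff ℝ 1 fun z : ℝ × ℝ =>
      (md K z.1, sn K z.1 * Real.cosh z.2, sn K z.1 * Real.sinh z.2) := by
    have := contDiff_md K
    have := contDiff_sn K
    fun_prop
  exact ContDiffAt.comp (r, θ) h1 h2.contDiffAt

end

lemma sn_mul_fderiv_R (hq : q ∈ c.U) (v : ℝ × ℝ) :
    sn K (c.R q) * fderiv ℝ c.R q v = fderiv ℝ c.h q v := by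
  have h1 : HasFDerivAt (fun q => md K (c.R q)) (sn K (c.R q) • fderiv ℝ c.R q) q :=
    (hasDerivAt_md K (c.R q)).comp_hasFDerivAt q
      ((c.contDiffAt_R hq).differentiableAt one_ne_zero).hasFDerivAt
  have h2 : (fun q => md K (c.R q)) =ᶠ[𝓝 q] c.h := by
    filter_upwards [c.isOpen_U.mem_nhds hq] with z hz using c.md_R hz
  rw [← h2.fderiv_eq, h1.fderiv]
  simp

/-- Differentiate `A = sn cosh Θ` and `B = sn sinh Θ`: in `A dB - B dA` the `dR` terms cancel and
`cosh² - sinh² = 1` leaves `sn² dΘ`. -/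
lemma sn_sq_mul_fderiv_Θ (hq : q ∈ c.U) (v : ℝ × ℝ) :
    sn K (c.R q) ^ 2 * fderiv ℝ c.Θ q v =
      c.A q * fderiv ℝ c.B q v - c.B q * fderiv ℝ c.A q v := by
  set s := fun q => sn K (c.R q) with hs
  have hR := ((c.contDiffAt_R hq).differentiableAt one_ne_zero).hasFDerivAt
  have hΘ := ((c.contDiffAt_Θ hq).differentiableAt one_ne_zero).hasFDerivAt
  have h1 : HasFDerivAt s (cs K (c.R q) • fderiv ℝ c.R q) q :=
    (hasDerivAt_sn K (c.R q)).comp_hasFDerivAt q hR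
  have hA : (fun q => s q * Real.cosh (c.Θ q)) =ᶠ[𝓝 q] c.A := by
    filter_upwards [c.isOpen_U.mem_nhds hq] with z hz using c.sn_mul_cosh hz
  have hB : (fun q => s q * Real.sinh (c.Θ q)) =ᶠ[𝓝 q] c.B := by
    filter_upwards [c.isOpen_U.mem_nhds hq] with z hz using c.sn_mul_sinh hz
  have hA' : fderiv ℝ (fun q => s q * Real.cosh (c.Θ q)) q = _ := (h1.mul hΘ.cosh).fderiv
  have hB' : fderiv ℝ (fun q => s q * Real.sinh (c.Θ q)) q = _ := (h1.mul hΘ.sinh).fderiv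
  rw [← hA.fderiv_eq, ← hB.fderiv_eq, hA', hB', ← c.sn_mul_cosh hq, ← c.sn_mul_sinh hq]
  simp only [add_apply, smul_apply, smul_eq_mul, hs]
  have := Real.cosh_sq (c.Θ q)
  linear_combination (-sn K (c.R q) ^ 2 * fderiv ℝ c.Θ q v) * this

/-- Dividing `metric_mul` by `sn²` on the domain gives the warped-product form, the only description
of the metric that the comparison uses. -/
lemma metric_eq (hq : q ∈ c.U) (v : ℝ × ℝ) :
    metric K q v v = (fderiv ℝ c.R q v) ^ 2 - sn K (c.R q) ^ 2 * (fderiv ℝ c.Θ q v) ^ 2 := by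
  have h1 := c.metric_mul q v
  have h0 := c.sn_R_pos hq
  have h2 : sn K (c.R q) ^ 2 = c.A q ^ 2 - c.B q ^ 2 := by
    rw [c.sn_R hq, Real.sq_sqrt (c.sq_sub_sq_pos hq).le]
  rw [← h2, ← c.sn_mul_fderiv_R hq, ← c.sn_sq_mul_fderiv_Θ hq] at h1
  have h3 : sn K (c.R q) ^ 2 ≠ 0 := (pow_pos h0 2).ne'
  refine mul_right_cancel₀ h3 (h1.trans ?_)
  ring

/-- If `dh v < 0`, some combination `w` of `v` and `∂ₜ` with positive coefficients lies in the
kernel of `dh`. As a sum of a future causal and a future timelike vector, `w` is timelike, but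
`metric_mul` makes the metric nonpositive on that kernel. -/
lemma fderiv_R_nonneg (hq : q ∈ c.U) (hv : IsFutureCausal K q v) : 0 ≤ fderiv ℝ c.R q v := by
  have h0 := c.sn_R_pos hq
  have hS := c.sq_sub_sq_pos hq
  refine nonneg_of_mul_nonneg_right (a := sn K (c.R q)) ?_ h0
  rw [c.sn_mul_fderiv_R hq]
  by_contra! hneg
  have hpos := c.fderiv_h_pos q hq
  set a := fderiv ℝ c.h q (1, 0) with ha
  set b := fderiv ℝ c.h q v with hb
  set w : ℝ × ℝ := a • v + (-b) • ((1 : ℝ), (0 : ℝ)) with hw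
  have h1 : fderiv ℝ c.h q w = 0 := by
    rw [hw, map_add, map_smul, map_smul, ← ha, ← hb]; simp only [smul_eq_mul]; ring
  have h2 := c.metric_mul q w
  rw [h1] at h2
  have h3 : metric K q w w = a ^ 2 * metric K q v v
      + Real.cosh (√K * q.2) ^ 2 * (2 * a * (-b) * v.1 + b ^ 2) := by
    simp only [metric, hw, Prod.fst_add, Prod.snd_add, Prod.smul_fst, Prod.smul_snd, smul_eq_mul]
    ring
  have h4 : 0 < metric K q w w := by
    rw [h3]
    have h5 := mul_nonneg (sq_nonneg a) hv.1
    have h6 : 0 < Real.cosh (√K * q.2) ^ 2 := pow_pos (Real.cosh_pos _) 2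
    have h7 : 0 ≤ 2 * a * (-b) * v.1 :=
      mul_nonneg (mul_nonneg (by positivity) (by linarith)) (isFuture_iff.1 hv.2)
    have h8 : 0 < b ^ 2 := by nlinarith
    have := mul_pos h6 (add_pos_of_nonneg_of_pos h7 h8)
    linarith
  have h5 := mul_pos h4 hS
  nlinarith [sq_nonneg (c.A q * fderiv ℝ c.B q w - c.B q * fderiv ℝ c.A q w)]

lemma hnorm_le_fderiv_R (hq : q ∈ c.U) (hv : IsFutureCausal K q v) :
    hnorm K q v ≤ fderiv ℝ c.R q v := by
  rw [hv.hnorm_eq]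
  refine Real.sqrt_le_iff.2 ⟨c.fderiv_R_nonneg hq hv, ?_⟩
  rw [c.metric_eq hq]
  have := mul_nonneg (sq_nonneg (sn K (c.R q))) (sq_nonneg (fderiv ℝ c.Θ q v))
  linarith

/-- A causal vector whose radial component is nonnegative is future-directed. -/
lemma isFutureCausal_of_fderiv_R (hq : q ∈ c.U) (hv : 0 ≤ metric K q v v)
    (hR : 0 ≤ fderiv ℝ c.R q v) : IsFutureCausal K q v := by
  by_cases h1 : 0 ≤ v.1
  · exact ⟨hv, isFuture_iff.2 h1⟩
  push Not at h1
  have h2 : IsFutureCausal K q (-v) :=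
    ⟨by rwa [metric_neg_neg], isFuture_iff.2 (by simpa using h1.le)⟩
  have h3 := c.fderiv_R_nonneg hq h2
  rw [map_neg] at h3
  have h4 : fderiv ℝ c.R q v = 0 := by linarith
  have hS := c.sn_R_pos hq
  have h5 := c.metric_eq hq v
  rw [h4] at h5
  have h6 : fderiv ℝ c.Θ q v = 0 := by
    by_contra h
    have : 0 < sn K (c.R q) ^ 2 * (fderiv ℝ c.Θ q v) ^ 2 := by positivity
    linarith
  -- For a past-pointing `v` both `dR v` and `dΘ v` vanish. Since `E` inverts `(R, Θ)`, this forces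
  -- `v = 0`, against `v.1 < 0`.
  have hE : HasFDerivAt (fun q => c.E (c.R q, c.Θ q))
      ((fderiv ℝ c.E (c.R q, c.Θ q)).comp ((fderiv ℝ c.R q).prod (fderiv ℝ c.Θ q))) q := by
    have e1 := ((c.contDiffAt_E (θ := c.Θ q) (c.R_pos hq).le
      (c.belowDiam_R hq)).differentiableAt one_ne_zero).hasFDerivAt
    exact HasFDerivAt.comp (f := fun q => (c.R q, c.Θ q)) q e1
      ((((c.contDiffAt_R hq).differentiableAt one_ne_zero).hasFDerivAt).prodMk
      (((c.contDiffAt_Θ hq).differentiableAt one_ne_zero).hasFDerivAt))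
  have hid : (fun q => c.E (c.R q, c.Θ q)) =ᶠ[𝓝 q] id := by
    filter_upwards [c.isOpen_U.mem_nhds hq] with z hz using c.E_R_Θ hz
  have h7 := hid.fderiv_eq (𝕜 := ℝ)
  rw [hE.fderiv, fderiv_id] at h7
  have h8 := congrArg (fun L => L v) h7
  simp [h4, h6] at h8
  rw [← h8, Prod.mk_zero_zero, map_zero] at h1
  exact (lt_irrefl _ h1).elim

end PolarChart
-- Derivatives along straight lines
lemma fderiv_eq_of_hasDerivAt {f : ℝ × ℝ → ℝ} {q v : ℝ × ℝ} {d : ℝ}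
    (hf : DifferentiableAt ℝ f q)
    (h : HasDerivAt (fun s : ℝ => f (q.1 + s * v.1, q.2 + s * v.2)) d 0) :
    fderiv ℝ f q v = d := by
  have h1 := hf.hasFDerivAt.hasLineDerivAt v
  exact HasDerivAt.unique h1 h

lemma hasDerivAt_add_mul (a b : ℝ) : HasDerivAt (fun s : ℝ => a + s * b) b 0 := by
  simpa using ((hasDerivAt_id (0 : ℝ)).mul_const b).const_add a

/-! ### Functions on the quadrics

For a circular coordinate `a` and a hyperbolic coordinate `b`, the following are the scalar products
of the point with coordinates `(a, b)` with an orthonormal frame at the point `(0, b₀)`. -/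

variable (k b₀ : ℝ)

def cF (a b : ℝ) : ℝ :=
  Real.cosh (k * b₀) * Real.cosh (k * b) * Real.cos (k * a)
    - Real.sinh (k * b₀) * Real.sinh (k * b)

def pF (a b : ℝ) : ℝ := Real.cosh (k * b) * Real.sin (k * a) / k

def qF (a b : ℝ) : ℝ :=
  (Real.cosh (k * b₀) * Real.sinh (k * b)
    - Real.sinh (k * b₀) * Real.cosh (k * b) * Real.cos (k * a)) / k

def cF' (a b u w : ℝ) : ℝ :=
  k * (-(Real.cosh (k * b₀) * Real.cosh (k * b) * Real.sin (k * a)) * u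
    + (Real.cosh (k * b₀) * Real.sinh (k * b) * Real.cos (k * a)
      - Real.sinh (k * b₀) * Real.cosh (k * b)) * w)

def pF' (a b u w : ℝ) : ℝ :=
  Real.cosh (k * b) * Real.cos (k * a) * u + Real.sinh (k * b) * Real.sin (k * a) * w

def qF' (a b u w : ℝ) : ℝ :=
  Real.sinh (k * b₀) * Real.cosh (k * b) * Real.sin (k * a) * u
    + (Real.cosh (k * b₀) * Real.cosh (k * b)
      - Real.sinh (k * b₀) * Real.sinh (k * b) * Real.cos (k * a)) * w

variable {k b₀} {a b : ℝ → ℝ} {u w s : ℝ}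

lemma hasDerivAt_cF (ha : HasDerivAt a u s) (hb : HasDerivAt b w s) :
    HasDerivAt (fun s => cF k b₀ (a s) (b s)) (cF' k b₀ (a s) (b s) u w) s := by
  have ha' := ha.const_mul k
  have hb' := hb.const_mul k
  refine (((hb'.cosh.const_mul (Real.cosh (k * b₀))).mul ha'.cos).sub
    (hb'.sinh.const_mul (Real.sinh (k * b₀)))).congr_deriv ?_
  simp only [cF']; ring

lemma hasDerivAt_pF (hk : k ≠ 0) (ha : HasDerivAt a u s) (hb : HasDerivAt b w s) :
    HasDerivAt (fun s => pF k (a s) (b s)) (pF' k (a s) (b s) u w) s := by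
  have ha' := ha.const_mul k
  have hb' := hb.const_mul k
  refine ((hb'.cosh.mul ha'.sin).div_const k).congr_deriv ?_
  simp only [pF']; field_simp; ring

lemma hasDerivAt_qF (hk : k ≠ 0) (ha : HasDerivAt a u s) (hb : HasDerivAt b w s) :
    HasDerivAt (fun s => qF k b₀ (a s) (b s)) (qF' k b₀ (a s) (b s) u w) s := by
  have ha' := ha.const_mul k
  have hb' := hb.const_mul k
  refine (((hb'.sinh.const_mul (Real.cosh (k * b₀))).sub
    ((hb'.cosh.const_mul (Real.sinh (k * b₀))).mul ha'.cos)).div_const k).congr_deriv ?_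
  simp only [qF']; field_simp; ring

/-- The equation of the quadric in the orthonormal frame at the base point: `cF` is the component
along the base point, `k * pF` and `k * qF` the tangential ones. -/
lemma cF_sq (hk : k ≠ 0) (a b : ℝ) :
    k ^ 2 * (pF k a b ^ 2 - qF k b₀ a b ^ 2) = 1 - cF k b₀ a b ^ 2 := by
  have h1 := Real.cosh_sq (k * b₀)
  have h2 := Real.cosh_sq (k * b)
  have h3 := Real.sin_sq (k * a)
  simp only [pF, qF, cF]
  generalize Real.cosh (k * b₀) = c0 at *
  generalize Real.sinh (k * b₀) = s0 at *
  generalize Real.cosh (k * b) = C at *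
  generalize Real.sinh (k * b) = S at *
  generalize Real.cos (k * a) = x at *
  generalize Real.sin (k * a) = y at *
  field_simp
  linear_combination C ^ 2 * h3 + (C ^ 2 * x ^ 2 - S ^ 2) * h1 + h2

/-- One identity serves both signs of curvature: passing from anti-de Sitter to de Sitter swaps time
and space, hence `pF` and `qF`, and reverses the sign of the metric. After `A dB - B dA` is put in
closed form it is polynomial modulo the Pythagorean relations. -/
lemma quadric_metric (hk : k ≠ 0) (a b u w : ℝ) :
    (Real.cosh (k * b) ^ 2 * u ^ 2 - w ^ 2) * (pF k a b ^ 2 - qF k b₀ a b ^ 2) =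
      (cF' k b₀ a b u w / k ^ 2) ^ 2
        - (pF k a b * qF' k b₀ a b u w - qF k b₀ a b * pF' k a b u w) ^ 2 := by
  have h1 := Real.cosh_sq (k * b₀)
  have h2 := Real.cosh_sq (k * b)
  have h3 := Real.sin_sq (k * a)
  have e : k * (pF k a b * qF' k b₀ a b u w - qF k b₀ a b * pF' k a b u w) =
      (Real.sinh (k * b₀) * Real.cosh (k * b)
        - Real.cosh (k * b₀) * Real.sinh (k * b) * Real.cos (k * a)) * Real.cosh (k * b) * u
      + Real.cosh (k * b₀) * Real.sin (k * a) * w := by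
    simp only [pF, qF, qF', pF']
    generalize Real.cosh (k * b₀) = c0 at *
    generalize Real.sinh (k * b₀) = s0 at *
    generalize Real.cosh (k * b) = C at *
    generalize Real.sinh (k * b) = S at *
    generalize Real.cos (k * a) = x at *
    generalize Real.sin (k * a) = y at *
    field_simp
    linear_combination (s0 * C ^ 2 * u) * h3 + (c0 * y * w) * h2
  have e2 := cF_sq (b₀ := b₀) hk a b
  refine mul_left_cancel₀ (pow_ne_zero 2 hk) ?_
  have e3 : k ^ 2 * ((cF' k b₀ a b u w / k ^ 2) ^ 2
        - (pF k a b * qF' k b₀ a b u w - qF k b₀ a b * pF' k a b u w) ^ 2) =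
      (cF' k b₀ a b u w / k) ^ 2
        - (k * (pF k a b * qF' k b₀ a b u w - qF k b₀ a b * pF' k a b u w)) ^ 2 := by
    field_simp
  rw [e3, e, show ∀ m d : ℝ, k ^ 2 * (m * d) = m * (k ^ 2 * d) by intros; ring, e2]
  simp only [cF, cF']
  rw [mul_div_cancel_left₀ _ hk]
  generalize Real.cosh (k * b₀) = c0 at *
  generalize Real.sinh (k * b₀) = s0 at *
  generalize Real.cosh (k * b) = C at *
  generalize Real.sinh (k * b) = S at *
  generalize Real.cos (k * a) = x at *
  generalize Real.sin (k * a) = y at *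
  linear_combination (C ^ 2 * u ^ 2 - w ^ 2) * ((s0 ^ 2 - c0 ^ 2 * x ^ 2) * h2 - h1 - c0 ^ 2 * h3)

/-- The coordinates of a point of the quadric, from its scalar products with the frame. -/
def quadricInv (k b₀ c p q : ℝ) : ℝ × ℝ :=
  (Complex.arg ⟨c * Real.cosh (k * b₀) + k * q * Real.sinh (k * b₀), k * p⟩ / k,
    Real.arsinh (c * Real.sinh (k * b₀) + k * q * Real.cosh (k * b₀)) / k)

lemma contDiffAt_arg {z : ℂ} (hz : z ∈ Complex.slitPlane) : ContDiffAt ℝ 1 Complex.arg z := by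
  have h1 : ContDiffAt ℝ 1 Complex.log z := (Complex.contDiffAt_log hz).restrict_scalars ℝ
  have h2 := Complex.imCLM.contDiff.contDiffAt.comp z h1 (n := 1)
  exact h2.congr_of_eventuallyEq (Eventually.of_forall fun w => (Complex.log_im w).symm)

lemma contDiffAt_quadricInv {E : Type*} [NormedAddCommGroup E] [NormedSpace ℝ E]
    {c p q : E → ℝ} {x : E} (hc : ContDiff ℝ 1 c) (hp : ContDiff ℝ 1 p) (hq : ContDiff ℝ 1 q)
    (h : 0 < c x * Real.cosh (k * b₀) + k * q x * Real.sinh (k * b₀) ∨ k * p x ≠ 0) :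
    ContDiffAt ℝ 1 (fun x => quadricInv k b₀ (c x) (p x) (q x)) x := by
  refine ContDiffAt.prodMk ?_ ?_
  · refine ContDiffAt.div_const ?_ k
    have h1 : ContDiffAt ℝ 1 Complex.arg
        ⟨c x * Real.cosh (k * b₀) + k * q x * Real.sinh (k * b₀), k * p x⟩ :=
      contDiffAt_arg (Complex.mem_slitPlane_iff.2 h)
    have h2 : ContDiff ℝ 1 fun x =>
        (⟨c x * Real.cosh (k * b₀) + k * q x * Real.sinh (k * b₀), k * p x⟩ : ℂ) :=
      Complex.equivRealProdCLM.symm.contDiff.comp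
        (f := fun x => (c x * Real.cosh (k * b₀) + k * q x * Real.sinh (k * b₀), k * p x))
        (by fun_prop)
    exact ContDiffAt.comp x h1 h2.contDiffAt
  · refine ContDiffAt.div_const (ContDiffAt.arsinh ?_) k
    exact ContDiff.contDiffAt (by fun_prop)

/-- The quadric equation says that the complex number built from the two circular components has
modulus equal to the hyperbolic cosine of the other coordinate (`h1`); its polar form then returns
the scalar products. -/
lemma quadricInv_spec (hk : k ≠ 0) {c p q : ℝ} (h : k ^ 2 * (p ^ 2 - q ^ 2) = 1 - c ^ 2) :
    cF k b₀ (quadricInv k b₀ c p q).1 (quadricInv k b₀ c p q).2 = c ∧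
    pF k (quadricInv k b₀ c p q).1 (quadricInv k b₀ c p q).2 = p ∧
    qF k b₀ (quadricInv k b₀ c p q).1 (quadricInv k b₀ c p q).2 = q := by
  have h0 := Real.cosh_sq (k * b₀)
  simp only [cF, pF, qF, quadricInv, mul_div_cancel₀ _ hk, Real.sinh_arsinh, Real.cosh_arsinh]
  set z : ℂ := ⟨c * Real.cosh (k * b₀) + k * q * Real.sinh (k * b₀), k * p⟩ with hz
  have h1 : √(1 + (c * Real.sinh (k * b₀) + k * q * Real.cosh (k * b₀)) ^ 2) = ‖z‖ := by
    rw [Complex.norm_def, Complex.normSq_apply]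
    congr 1
    simp only [hz]
    linear_combination (k ^ 2 * q ^ 2 - c ^ 2) * h0 - h
  have h2 := Complex.norm_mul_cos_arg z
  have h3 := Complex.norm_mul_sin_arg z
  rw [h1]
  refine ⟨?_, ?_, ?_⟩
  · rw [mul_assoc, h2]
    simp only [hz]
    linear_combination c * h0
  · rw [h3]
    simp only [hz]
    field_simp
  · rw [mul_assoc (Real.sinh (k * b₀)), h2]
    simp only [hz]
    field_simp
    linear_combination (k * q) * h0

lemma quadricInv_apply (hk : k ≠ 0) {a b : ℝ} (h1 : -Real.pi < k * a) (h2 : k * a ≤ Real.pi) :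
    quadricInv k b₀ (cF k b₀ a b) (pF k a b) (qF k b₀ a b) = (a, b) := by
  have h0 := Real.cosh_sq (k * b₀)
  have e1 : cF k b₀ a b * Real.cosh (k * b₀) + k * qF k b₀ a b * Real.sinh (k * b₀) =
      Real.cosh (k * b) * Real.cos (k * a) := by
    simp only [cF, qF]; field_simp
    linear_combination (Real.cosh (k * b) * Real.cos (k * a)) * h0
  have e2 : cF k b₀ a b * Real.sinh (k * b₀) + k * qF k b₀ a b * Real.cosh (k * b₀) =
      Real.sinh (k * b) := by
    simp only [cF, qF]; field_simp
    linear_combination (Real.sinh (k * b)) * h0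
  have e3 : k * pF k a b = Real.cosh (k * b) * Real.sin (k * a) := by
    simp only [pF]; field_simp
  have e4 : (⟨Real.cosh (k * b) * Real.cos (k * a), Real.cosh (k * b) * Real.sin (k * a)⟩ : ℂ) =
      (Real.cosh (k * b) : ℂ) * (Complex.cos (k * a : ℝ) + Complex.sin (k * a : ℝ) * Complex.I) := by
    rw [← Complex.ofReal_cos, ← Complex.ofReal_sin]
    apply Complex.ext <;> simp [-Complex.ofReal_cosh, -Complex.ofReal_cos, -Complex.ofReal_sin]
  rw [quadricInv, e1, e2, e3, e4, Complex.arg_mul_cos_add_sin_mul_I (Real.cosh_pos _) ⟨h1, h2⟩,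
    Real.arsinh_sinh, mul_div_cancel_left₀ _ hk, mul_div_cancel_left₀ _ hk]

lemma contDiff_cF (k b₀ : ℝ) : ContDiff ℝ 1 fun z : ℝ × ℝ => cF k b₀ z.1 z.2 := by
  unfold cF; fun_prop

lemma contDiff_pF (k : ℝ) : ContDiff ℝ 1 fun z : ℝ × ℝ => pF k z.1 z.2 := by
  unfold pF; fun_prop

lemma contDiff_qF (k b₀ : ℝ) : ContDiff ℝ 1 fun z : ℝ × ℝ => qF k b₀ z.1 z.2 := by
  unfold qF; fun_prop

lemma cF_self (k b₀ : ℝ) : cF k b₀ 0 b₀ = 1 := by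
  have := Real.cosh_sq (k * b₀)
  simp [cF]; linarith

lemma pF_self (k b₀ : ℝ) : pF k 0 b₀ = 0 := by simp [pF]

lemma qF_self (k b₀ : ℝ) : qF k b₀ 0 b₀ = 0 := by simp [qF, mul_comm]

lemma quadricInv_self {k b₀ : ℝ} (hk : k ≠ 0) : quadricInv k b₀ 1 0 0 = (0, b₀) := by
  have h := quadricInv_apply (b₀ := b₀) hk (a := 0) (b := b₀) (by simpa using Real.pi_pos)
    (by simpa using Real.pi_pos.le)
  rwa [cF_self, pF_self, qF_self] at h

/-- The value is `cosh (k b₀ - k b)`. With the next lemma, where it is `-cosh (k b₀ + k b)`, it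
excludes faces of the coordinate strip from the polar domain. -/
lemma cF_zero_le (k b₀ b : ℝ) : 1 ≤ cF k b₀ 0 b := by
  have := Real.one_le_cosh (k * b₀ - k * b)
  rw [Real.cosh_sub] at this
  simpa [cF] using this

lemma cF_le_of_eq_pi {k b₀ a b : ℝ} (h : k * a = Real.pi) : cF k b₀ a b ≤ -1 := by
  have := Real.one_le_cosh (k * b₀ + k * b)
  rw [Real.cosh_add] at this
  simp only [cF, h, Real.cos_pi]
  linarith

/-! ### Polar charts of the three model planes -/

/-- Polar coordinates in anti-de Sitter space. -/
def adsChart {K : ℝ} (hK : 0 < K) (p : ℝ × ℝ) : PolarChart K p :=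
  have hk : 0 < √K := Real.sqrt_pos.2 hK
  have hk2 : √K ^ 2 = K := Real.sq_sqrt hK.le
  have hK0 : √(-K) = 0 := Real.sqrt_eq_zero_of_nonpos (by linarith)
  have dh : ContDiff ℝ 1 fun q : ℝ × ℝ => (1 - cF √K p.2 (q.1 - p.1) q.2) / K :=
    (contDiff_const.sub ((contDiff_cF √K p.2).comp
      (f := fun q : ℝ × ℝ => (q.1 - p.1, q.2)) (by fun_prop))).div_const K
  have dA : ContDiff ℝ 1 fun q : ℝ × ℝ => pF √K (q.1 - p.1) q.2 :=
    (contDiff_pF √K).comp (f := fun q : ℝ × ℝ => (q.1 - p.1, q.2)) (by fun_prop)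
  have dB : ContDiff ℝ 1 fun q : ℝ × ℝ => qF √K p.2 (q.1 - p.1) q.2 :=
    (contDiff_qF √K p.2).comp (f := fun q : ℝ × ℝ => (q.1 - p.1, q.2)) (by fun_prop)
  have h1 : ∀ q v : ℝ × ℝ, HasDerivAt (fun s : ℝ => q.1 + s * v.1 - p.1) v.1 0 := fun q v =>
    (hasDerivAt_add_mul _ _).sub_const _
  have h2 : ∀ q v : ℝ × ℝ, HasDerivAt (fun s : ℝ => q.2 + s * v.2) v.2 0 := fun q v =>
    hasDerivAt_add_mul _ _
  have fh : ∀ q v : ℝ × ℝ, fderiv ℝ (fun q : ℝ × ℝ => (1 - cF √K p.2 (q.1 - p.1) q.2) / K) q v =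
      -cF' √K p.2 (q.1 - p.1) q.2 v.1 v.2 / K := fun q v =>
    fderiv_eq_of_hasDerivAt (dh.differentiable one_ne_zero q)
      ((((hasDerivAt_cF (h1 q v) (h2 q v)).const_sub 1).div_const K).congr_deriv (by simp))
  have fA : ∀ q v : ℝ × ℝ, fderiv ℝ (fun q : ℝ × ℝ => pF √K (q.1 - p.1) q.2) q v =
      pF' √K (q.1 - p.1) q.2 v.1 v.2 := fun q v =>
    fderiv_eq_of_hasDerivAt (dA.differentiable one_ne_zero q)
      ((hasDerivAt_pF hk.ne' (h1 q v) (h2 q v)).congr_deriv (by simp))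
  have fB : ∀ q v : ℝ × ℝ, fderiv ℝ (fun q : ℝ × ℝ => qF √K p.2 (q.1 - p.1) q.2) q v =
      qF' √K p.2 (q.1 - p.1) q.2 v.1 v.2 := fun q v =>
    fderiv_eq_of_hasDerivAt (dB.differentiable one_ne_zero q)
      ((hasDerivAt_qF hk.ne' (h1 q v) (h2 q v)).congr_deriv (by simp))
  have quad : ∀ {m a b : ℝ}, a ^ 2 - b ^ 2 = m * (2 - K * m) →
      √K ^ 2 * (a ^ 2 - b ^ 2) = 1 - (1 - K * m) ^ 2 := fun h => by rw [h, hk2]; ring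
  -- On the domain `cF = cos (√K R)`; the bounds on the time difference select the right sheet of
  -- the universal cover.
  { U := {q | 0 < √K * (q.1 - p.1) ∧ √K * (q.1 - p.1) < Real.pi ∧
        -1 < cF √K p.2 (q.1 - p.1) q.2 ∧ cF √K p.2 (q.1 - p.1) q.2 < 1}
    h := fun q => (1 - cF √K p.2 (q.1 - p.1) q.2) / K
    A := fun q => pF √K (q.1 - p.1) q.2
    B := fun q => qF √K p.2 (q.1 - p.1) q.2
    G := fun z => (p.1 + (quadricInv √K p.2 (1 - K * z.1) z.2.1 z.2.2).1,
      (quadricInv √K p.2 (1 - K * z.1) z.2.1 z.2.2).2)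
    isOpen_U := by
      have hc : Continuous fun q : ℝ × ℝ => cF √K p.2 (q.1 - p.1) q.2 := by unfold cF; fun_prop
      exact (isOpen_lt (by fun_prop) (by fun_prop)).and
        ((isOpen_lt (by fun_prop) (by fun_prop)).and
        ((isOpen_lt (by fun_prop) hc).and (isOpen_lt hc (by fun_prop))))
    contDiff_h := dh
    contDiff_A := dA
    contDiff_B := dB
    rel := fun q => by
      have := cF_sq (b₀ := p.2) hk.ne' (q.1 - p.1) q.2
      rw [hk2] at this
      have hK' := hK.ne'
      field_simp
      linarith
    metric_mul := fun q v => by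
      rw [fh, fA, fB]
      have := quadric_metric (b₀ := p.2) hk.ne' (q.1 - p.1) q.2 v.1 v.2
      rw [hk2] at this
      rw [neg_div, neg_sq, ← this, metric, hK0]
      simp only [zero_mul, Real.cosh_zero]
      ring
    A_pos := fun q hq => div_pos (mul_pos (Real.cosh_pos _)
      (Real.sin_pos_of_pos_of_lt_pi hq.1 hq.2.1)) hk
    h_pos := fun q hq => div_pos (by linarith [hq.2.2.2]) hK
    mul_h_lt := fun q hq => by rw [mul_div_cancel₀ _ hK.ne']; linarith [hq.2.2.1]
    fderiv_h_pos := fun q hq => by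
      rw [fh]
      have := mul_pos hk (mul_pos (mul_pos (Real.cosh_pos (√K * p.2)) (Real.cosh_pos (√K * q.2)))
        (Real.sin_pos_of_pos_of_lt_pi hq.1 hq.2.1))
      refine div_pos ?_ hK
      simp only [cF']
      linarith
    mem_of_closure := fun q hq h1 h2 => by
      have hcl : q ∈ {q : ℝ × ℝ | 0 ≤ √K * (q.1 - p.1) ∧ √K * (q.1 - p.1) ≤ Real.pi} :=
        closure_minimal (fun z hz => And.intro hz.1.le hz.2.1.le)
          ((isClosed_le (by fun_prop) (by fun_prop)).and
            (isClosed_le (by fun_prop) (by fun_prop))) hq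
      rw [mul_div_cancel₀ _ hK.ne'] at h2
      have h1' := (div_pos_iff_of_pos_right hK).1 h1
      refine ⟨lt_of_le_of_ne hcl.1 fun h => ?_, lt_of_le_of_ne hcl.2 fun h => ?_, by linarith,
        by linarith⟩
      · rw [(mul_eq_zero.1 h.symm).resolve_left hk.ne'] at h1'
        linarith [cF_zero_le √K p.2 q.2]
      · linarith [cF_le_of_eq_pi (b₀ := p.2) (b := q.2) h]
    eventually_mem := by
      have hc : Continuous fun q : ℝ × ℝ => cF √K p.2 (q.1 - p.1) q.2 := by unfold cF; fun_prop
      have e1 : ∀ᶠ q in 𝓝 p, -1 < cF √K p.2 (q.1 - p.1) q.2 :=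
        hc.continuousAt.eventually_const_lt (by simp [cF_self])
      have e2 : ∀ᶠ q : ℝ × ℝ in 𝓝 p, √K * (q.1 - p.1) < Real.pi :=
        (Continuous.continuousAt (by fun_prop)).eventually_lt_const (by simpa using Real.pi_pos)
      filter_upwards [e1, e2] with q h1 h2 h3 h4
      exact ⟨mul_pos hk (by linarith), h2, h1,
        by linarith [(div_pos_iff_of_pos_right hK).1 h4]⟩
    h_self := by simp [cF_self]
    A_self := by simp [pF_self]
    B_self := by simp [qF_self]
    metric_self := fun v w => by
      have := Real.cosh_sq (√K * p.2)
      simp only [fA, fB, pF', qF', metric, hK0, sub_self, mul_zero, Real.cos_zero, Real.sin_zero,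
        zero_mul, Real.cosh_zero]
      linear_combination (-(v.2 * w.2) * (Real.cosh (√K * p.2) ^ 2 - Real.sinh (√K * p.2) ^ 2 + 1))
        * this
    fderiv_A_pos := fun v hv => by
      simp only [fA, pF', sub_self, mul_zero, Real.cos_zero, Real.sin_zero, zero_mul, mul_one,
        add_zero]
      exact mul_pos (Real.cosh_pos _) hv
    contDiffAt_G := fun m a b hm hKm ha hab => by
      have hG : ContDiffAt ℝ 1 (fun z : ℝ × ℝ × ℝ => quadricInv √K p.2 (1 - K * z.1) z.2.1 z.2.2)
          (m, a, b) := by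
        refine contDiffAt_quadricInv (by fun_prop) (by fun_prop) (by fun_prop) ?_
        -- With `a = 0` the relation forces `m = b = 0`. This is the vertex, where the real part of
        -- the argument is `cosh (√K p.2) > 0`.
        rcases ha.eq_or_lt with rfl | ha
        · left
          have h1 : m * (2 - K * m) = 0 := by
            have := mul_nonneg hm (sub_pos.2 hKm).le
            nlinarith [sq_nonneg b]
          have h2 : m = 0 := (mul_eq_zero.1 h1).resolve_right (by linarith)
          have h3 : b = 0 := by
            rw [h1] at hab
            nlinarith [sq_nonneg b]
          simpa [h2, h3] using Real.cosh_pos _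
        · right
          exact (mul_pos hk ha).ne'
      exact (contDiffAt_const.add (contDiff_fst.contDiffAt.comp _ hG)).prodMk
        (contDiff_snd.contDiffAt.comp _ hG)
    G_mem := fun m a b hm hKm ha hab => by
      obtain ⟨h1, h2, h3⟩ := quadricInv_spec (b₀ := p.2) hk.ne' (quad hab)
      have h4 : 0 < √K * a := mul_pos hk ha
      simp only [Set.mem_ofPred_eq, add_sub_cancel_left, h1]
      simp only [quadricInv, mul_div_cancel₀ _ hk.ne']
      refine ⟨lt_of_le_of_ne (Complex.arg_nonneg_iff.2 h4.le) fun h => ?_,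
        Complex.arg_lt_pi_iff.2 (Or.inr h4.ne'), by linarith, by nlinarith⟩
      exact h4.ne' (Complex.arg_eq_zero_iff.1 h.symm).2
    h_G := fun m a b hm hKm ha hab => by
      obtain ⟨h1, h2, h3⟩ := quadricInv_spec (b₀ := p.2) hk.ne' (quad hab)
      simp only [add_sub_cancel_left, h1, sub_sub_cancel]
      exact mul_div_cancel_left₀ _ hK.ne'
    A_G := fun m a b hm hKm ha hab => by
      obtain ⟨h1, h2, h3⟩ := quadricInv_spec (b₀ := p.2) hk.ne' (quad hab)
      simp only [add_sub_cancel_left, h2]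
    B_G := fun m a b hm hKm ha hab => by
      obtain ⟨h1, h2, h3⟩ := quadricInv_spec (b₀ := p.2) hk.ne' (quad hab)
      simp only [add_sub_cancel_left, h3]
    G_apply := fun q hq => by
      have hpi := Real.pi_pos
      simp only [mul_div_cancel₀ _ hK.ne', sub_sub_cancel]
      rw [quadricInv_apply hk.ne' (by linarith [hq.1]) hq.2.1.le]
      simp
    G_zero := by
      simp only [mul_zero, sub_zero, quadricInv_self hk.ne', add_zero] }

/-- Signs on the future of a point of de Sitter space: `C, S` and `C₀, S₀` are hyperbolic cosines
and sines of time coordinates, `x` is the cosine of a difference of space coordinates. -/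
lemma deSitter_pos {C S C₀ S₀ x : ℝ} (hC : C ^ 2 = S ^ 2 + 1) (hC₀ : C₀ ^ 2 = S₀ ^ 2 + 1)
    (hCp : 0 < C) (hC₀p : 0 < C₀) (hx : x ≤ 1) (hc : 1 < C₀ * C * x - S₀ * S) (h : S₀ < S) :
    0 < C₀ * S - S₀ * C * x ∧ 0 < C₀ * S * x - S₀ * C := by
  -- Here `C₀ * S - S₀ * C` is the hyperbolic sine of the time difference.
  have key : ∀ {C S C₀ S₀ : ℝ}, C ^ 2 = S ^ 2 + 1 → C₀ ^ 2 = S₀ ^ 2 + 1 → 0 < C → 0 < C₀ →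
      0 ≤ S₀ → S₀ < S → 0 < C₀ * S - S₀ * C := fun {C S C₀ S₀} hC hC₀ hCp hC₀p h0 h => by
    rw [sub_pos]
    refine lt_of_pow_lt_pow_left₀ 2 (by nlinarith) ?_
    rw [mul_pow, mul_pow, hC, hC₀]
    nlinarith
  constructor
  -- For `S₀ ≥ 0`, the worst case is `x = 1`. For `S₀ < 0`, multiplying `hc` by `-S₀` bounds `C₀`
  -- times the goal below by `S - S₀`.
  · rcases le_or_gt 0 S₀ with h0 | h0
    · have h1 := key hC hC₀ hCp hC₀p h0 h
      have h2 : S₀ * C * x ≤ S₀ * C * 1 := mul_le_mul_of_nonneg_left hx (by positivity)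
      linarith
    · refine pos_of_mul_pos_right (a := C₀) ?_ hC₀p.le
      have := mul_lt_mul_of_pos_left hc (neg_pos.2 h0)
      nlinarith
  · rcases le_or_gt 0 S with h0 | h0
    · refine pos_of_mul_pos_right (a := C) ?_ hCp.le
      have := mul_le_mul_of_nonneg_left hc.le h0
      nlinarith
    · have h1 := key (C := C₀) (S := -S₀) (C₀ := C) (S₀ := -S) (by linarith) (by linarith) hC₀p hCp
        (by linarith) (by linarith)
      have h2 : C₀ * (-S) * x ≤ C₀ * (-S) * 1 :=
        mul_le_mul_of_nonneg_left hx (mul_nonneg hC₀p.le (by linarith))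
      linarith

/-- A converse to `deSitter_pos`: a positive `A` puts the point reconstructed by `G` to the future
of `p`, rather than in the past component of the same level set. -/
lemma deSitter_lt {C S C₀ S₀ x : ℝ} (hC : C ^ 2 = S ^ 2 + 1) (hC₀ : C₀ ^ 2 = S₀ ^ 2 + 1)
    (hCp : 0 < C) (hC₀p : 0 < C₀) (hx : x ≤ 1) (hc : 1 < C₀ * C * x - S₀ * S)
    (h : 0 < C₀ * S - S₀ * C * x) : S₀ < S := by
  rcases le_or_gt 0 S₀ with h0 | h0
  · have h1 := mul_pos hC₀p h
    have h2 := mul_le_mul_of_nonneg_left hc.le h0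
    nlinarith
  · by_contra! hS
    have h2 : -S₀ * C * x ≤ -S₀ * C * 1 := mul_le_mul_of_nonneg_left hx
      (mul_nonneg (by linarith) hCp.le)
    have h3 : C₀ * -S < -S₀ * C := by linarith
    have h4 := pow_lt_pow_left₀ h3 (mul_nonneg hC₀p.le (by linarith)) two_ne_zero
    rw [mul_pow, mul_pow, hC, hC₀] at h4
    nlinarith

/-- Polar coordinates in de Sitter space. -/
def deSitterChart {K : ℝ} (hK : K < 0) (p : ℝ × ℝ) : PolarChart K p :=
  have hk : 0 < √(-K) := Real.sqrt_pos.2 (by linarith)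
  have hk2 : √(-K) ^ 2 = -K := Real.sq_sqrt (by linarith)
  have hK0 : √K = 0 := Real.sqrt_eq_zero_of_nonpos hK.le
  have dh : ContDiff ℝ 1 fun q : ℝ × ℝ => (1 - cF √(-K) p.1 (q.2 - p.2) q.1) / K :=
    (contDiff_const.sub ((contDiff_cF √(-K) p.1).comp
      (f := fun q : ℝ × ℝ => (q.2 - p.2, q.1)) (by fun_prop))).div_const K
  have dB : ContDiff ℝ 1 fun q : ℝ × ℝ => pF √(-K) (q.2 - p.2) q.1 :=
    (contDiff_pF √(-K)).comp (f := fun q : ℝ × ℝ => (q.2 - p.2, q.1)) (by fun_prop)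
  have dA : ContDiff ℝ 1 fun q : ℝ × ℝ => qF √(-K) p.1 (q.2 - p.2) q.1 :=
    (contDiff_qF √(-K) p.1).comp (f := fun q : ℝ × ℝ => (q.2 - p.2, q.1)) (by fun_prop)
  have h1 : ∀ q v : ℝ × ℝ, HasDerivAt (fun s : ℝ => q.2 + s * v.2 - p.2) v.2 0 := fun q v =>
    (hasDerivAt_add_mul _ _).sub_const _
  have h2 : ∀ q v : ℝ × ℝ, HasDerivAt (fun s : ℝ => q.1 + s * v.1) v.1 0 := fun q v =>
    hasDerivAt_add_mul _ _
  have fh : ∀ q v : ℝ × ℝ,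
      fderiv ℝ (fun q : ℝ × ℝ => (1 - cF √(-K) p.1 (q.2 - p.2) q.1) / K) q v =
      -cF' √(-K) p.1 (q.2 - p.2) q.1 v.2 v.1 / K := fun q v =>
    fderiv_eq_of_hasDerivAt (dh.differentiable one_ne_zero q)
      ((((hasDerivAt_cF (h1 q v) (h2 q v)).const_sub 1).div_const K).congr_deriv (by simp))
  have fB : ∀ q v : ℝ × ℝ, fderiv ℝ (fun q : ℝ × ℝ => pF √(-K) (q.2 - p.2) q.1) q v =
      pF' √(-K) (q.2 - p.2) q.1 v.2 v.1 := fun q v =>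
    fderiv_eq_of_hasDerivAt (dB.differentiable one_ne_zero q)
      ((hasDerivAt_pF hk.ne' (h1 q v) (h2 q v)).congr_deriv (by simp))
  have fA : ∀ q v : ℝ × ℝ, fderiv ℝ (fun q : ℝ × ℝ => qF √(-K) p.1 (q.2 - p.2) q.1) q v =
      qF' √(-K) p.1 (q.2 - p.2) q.1 v.2 v.1 := fun q v =>
    fderiv_eq_of_hasDerivAt (dA.differentiable one_ne_zero q)
      ((hasDerivAt_qF hk.ne' (h1 q v) (h2 q v)).congr_deriv (by simp))
  have quad : ∀ {m a b : ℝ}, a ^ 2 - b ^ 2 = m * (2 - K * m) →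
      √(-K) ^ 2 * (b ^ 2 - a ^ 2) = 1 - (1 - K * m) ^ 2 := fun h => by
    rw [hk2]; linear_combination K * h
  have signs : ∀ {t x : ℝ}, p.1 < t → 1 < cF √(-K) p.1 x t →
      0 < qF √(-K) p.1 x t ∧ 0 < cF' √(-K) p.1 x t 0 1 := fun {t x} ht hc => by
    have hs := Real.sinh_lt_sinh.2 (mul_lt_mul_of_pos_left ht hk)
    obtain ⟨h1, h2⟩ := deSitter_pos (Real.cosh_sq _) (Real.cosh_sq _) (Real.cosh_pos _)
      (Real.cosh_pos _) (Real.cos_le_one _) hc hs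
    refine ⟨div_pos h1 hk, ?_⟩
    have := mul_pos hk h2
    simp only [cF']
    linarith
  -- Now time is the hyperbolic coordinate and space the circular one, so `A` is `qF` and `B` is
  -- `pF`. On the domain `cF = cosh (√(-K) R)`.
  { U := {q | p.1 < q.1 ∧ -Real.pi < √(-K) * (q.2 - p.2) ∧ √(-K) * (q.2 - p.2) < Real.pi ∧
        1 < cF √(-K) p.1 (q.2 - p.2) q.1}
    h := fun q => (1 - cF √(-K) p.1 (q.2 - p.2) q.1) / K
    A := fun q => qF √(-K) p.1 (q.2 - p.2) q.1
    B := fun q => pF √(-K) (q.2 - p.2) q.1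
    G := fun z => ((quadricInv √(-K) p.1 (1 - K * z.1) z.2.2 z.2.1).2,
      p.2 + (quadricInv √(-K) p.1 (1 - K * z.1) z.2.2 z.2.1).1)
    isOpen_U := by
      have hc : Continuous fun q : ℝ × ℝ => cF √(-K) p.1 (q.2 - p.2) q.1 := by unfold cF; fun_prop
      exact (isOpen_lt (by fun_prop) (by fun_prop)).and
        ((isOpen_lt (by fun_prop) (by fun_prop)).and
        ((isOpen_lt (by fun_prop) (by fun_prop)).and (isOpen_lt (by fun_prop) hc)))
    contDiff_h := dh
    contDiff_A := dA
    contDiff_B := dB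
    rel := fun q => by
      have := cF_sq (b₀ := p.1) hk.ne' (q.2 - p.2) q.1
      rw [hk2] at this
      have hK' := hK.ne
      field_simp
      linarith
    metric_mul := fun q v => by
      rw [fh, fA, fB]
      have := quadric_metric (b₀ := p.1) hk.ne' (q.2 - p.2) q.1 v.2 v.1
      rw [hk2] at this
      rw [neg_div, ← div_neg, metric, hK0]
      simp only [zero_mul, Real.cosh_zero]
      linear_combination this
    A_pos := fun q hq => (signs hq.1 hq.2.2.2).1
    h_pos := fun q hq => div_pos_of_neg_of_neg (by linarith [hq.2.2.2]) hK
    mul_h_lt := fun q hq => by rw [mul_div_cancel₀ _ hK.ne]; linarith [hq.2.2.2]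
    fderiv_h_pos := fun q hq => by
      rw [fh]
      exact div_pos_of_neg_of_neg (neg_lt_zero.2 (signs hq.1 hq.2.2.2).2) hK
    mem_of_closure := fun q hq h1 h2 => by
      have hcl : q ∈ {q : ℝ × ℝ | p.1 ≤ q.1 ∧ -Real.pi ≤ √(-K) * (q.2 - p.2) ∧
          √(-K) * (q.2 - p.2) ≤ Real.pi} :=
        closure_minimal (fun z hz => And.intro hz.1.le (And.intro hz.2.1.le hz.2.2.1.le))
          ((isClosed_le (by fun_prop) (by fun_prop)).and
            ((isClosed_le (by fun_prop) (by fun_prop)).and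
            (isClosed_le (by fun_prop) (by fun_prop)))) hq
      have h1' : 1 < cF √(-K) p.1 (q.2 - p.2) q.1 := by
        by_contra! h
        exact (div_nonpos_of_nonneg_of_nonpos (by linarith) hK.le).not_gt h1
      refine ⟨lt_of_le_of_ne hcl.1 fun h => ?_, lt_of_le_of_ne hcl.2.1 fun h => ?_,
        lt_of_le_of_ne hcl.2.2 fun h => ?_, h1'⟩
      · rw [← h] at h1'
        have h3 := Real.cosh_sq (√(-K) * p.1)
        have h4 := Real.cos_le_one (√(-K) * (q.2 - p.2))
        have h5 := mul_le_mul_of_nonneg_left h4 (sq_nonneg (Real.cosh (√(-K) * p.1)))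
        simp only [cF] at h1'
        nlinarith
      · have h3 := cF_le_of_eq_pi (k := √(-K)) (b₀ := p.1) (a := -(q.2 - p.2)) (b := q.1)
          (by linarith)
        have h4 : cF √(-K) p.1 (-(q.2 - p.2)) q.1 = cF √(-K) p.1 (q.2 - p.2) q.1 := by
          simp only [cF, mul_neg, Real.cos_neg]
        linarith
      · linarith [cF_le_of_eq_pi (b₀ := p.1) (b := q.1) h]
    eventually_mem := by
      have e1 : ∀ᶠ q : ℝ × ℝ in 𝓝 p, -Real.pi < √(-K) * (q.2 - p.2) :=
        (Continuous.continuousAt (by fun_prop)).eventually_const_lt (by simpa using Real.pi_pos)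
      have e2 : ∀ᶠ q : ℝ × ℝ in 𝓝 p, √(-K) * (q.2 - p.2) < Real.pi :=
        (Continuous.continuousAt (by fun_prop)).eventually_lt_const (by simpa using Real.pi_pos)
      filter_upwards [e1, e2] with q h1 h2 h3 h4
      refine ⟨h3, h1, h2, ?_⟩
      by_contra! h
      exact (div_nonpos_of_nonneg_of_nonpos (by linarith) hK.le).not_gt h4
    h_self := by simp [cF_self]
    A_self := by simp [qF_self]
    B_self := by simp [pF_self]
    metric_self := fun v w => by
      have := Real.cosh_sq (√(-K) * p.1)
      simp only [fA, fB, pF', qF', metric, hK0, sub_self, mul_zero, Real.cos_zero, Real.sin_zero,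
        zero_mul, Real.cosh_zero]
      linear_combination (v.1 * w.1 * (Real.cosh (√(-K) * p.1) ^ 2
        - Real.sinh (√(-K) * p.1) ^ 2 + 1)) * this
    fderiv_A_pos := fun v hv => by
      have := Real.cosh_sq (√(-K) * p.1)
      simp only [fA, qF', sub_self, mul_zero, Real.cos_zero, Real.sin_zero, zero_mul, mul_one,
        zero_add]
      nlinarith
    contDiffAt_G := fun m a b hm hKm ha hab => by
      have hG : ContDiffAt ℝ 1
          (fun z : ℝ × ℝ × ℝ => quadricInv √(-K) p.1 (1 - K * z.1) z.2.2 z.2.1) (m, a, b) := by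
        refine contDiffAt_quadricInv (by fun_prop) (by fun_prop) (by fun_prop) ?_
        -- For `b = 0` the real part is positive since `√(-K) a < 1 - K m` and `|sinh| < cosh`;
        -- otherwise the imaginary part is nonzero.
        rcases eq_or_ne b 0 with rfl | hb
        · left
          have h1 : (√(-K) * a) ^ 2 = (1 - K * m) ^ 2 - 1 := by
            rw [mul_pow, hk2]; linear_combination (-K) * hab
          have h2 : √(-K) * a < 1 - K * m :=
            lt_of_pow_lt_pow_left₀ 2 (by nlinarith) (by rw [h1]; linarith)
          have h3 : |Real.sinh (√(-K) * p.1)| < Real.cosh (√(-K) * p.1) := by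
            refine abs_lt_of_sq_lt_sq ?_ (Real.cosh_pos _).le
            rw [Real.cosh_sq]; linarith
          have h4 := (abs_lt.1 h3).1
          have h5 : 0 ≤ √(-K) * a := mul_nonneg hk.le ha
          have h6 := Real.cosh_pos (√(-K) * p.1)
          have h7 := mul_lt_mul_of_pos_right h2 h6
          have h8 := mul_le_mul_of_nonneg_left h4.le h5
          simp only
          linarith
        · exact Or.inr (mul_ne_zero hk.ne' hb)
      exact (contDiff_snd.contDiffAt.comp _ hG).prodMk
        (contDiffAt_const.add (contDiff_fst.contDiffAt.comp _ hG))
    G_mem := fun m a b hm hKm ha hab => by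
      obtain ⟨h1, h2, h3⟩ := quadricInv_spec (b₀ := p.1) hk.ne' (quad hab)
      have hc : 1 < 1 - K * m := by nlinarith
      have h4 : p.1 < (quadricInv √(-K) p.1 (1 - K * m) b a).2 := by
        rw [← h1] at hc
        rw [← h3] at ha
        have := deSitter_lt (Real.cosh_sq _) (Real.cosh_sq _) (Real.cosh_pos _)
          (Real.cosh_pos _) (Real.cos_le_one _) hc ((div_pos_iff_of_pos_right hk).1 ha)
        exact lt_of_mul_lt_mul_left (Real.sinh_lt_sinh.1 this) hk.le
      have hpi : √(-K) * (quadricInv √(-K) p.1 (1 - K * m) b a).1 ≤ Real.pi := by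
        simp only [quadricInv, mul_div_cancel₀ _ hk.ne']
        exact Complex.arg_le_pi _
      have hpi' : -Real.pi < √(-K) * (quadricInv √(-K) p.1 (1 - K * m) b a).1 := by
        simp only [quadricInv, mul_div_cancel₀ _ hk.ne']
        exact Complex.neg_pi_lt_arg _
      simp only [Set.mem_ofPred_eq, add_sub_cancel_left, h1]
      refine ⟨h4, hpi', lt_of_le_of_ne hpi fun h => ?_, hc⟩
      have := cF_le_of_eq_pi (b₀ := p.1) (b := (quadricInv √(-K) p.1 (1 - K * m) b a).2) h
      linarith
    h_G := fun m a b hm hKm ha hab => by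
      obtain ⟨h1, h2, h3⟩ := quadricInv_spec (b₀ := p.1) hk.ne' (quad hab)
      simp only [add_sub_cancel_left, h1, sub_sub_cancel]
      exact mul_div_cancel_left₀ _ hK.ne
    A_G := fun m a b hm hKm ha hab => by
      obtain ⟨h1, h2, h3⟩ := quadricInv_spec (b₀ := p.1) hk.ne' (quad hab)
      simp only [add_sub_cancel_left, h3]
    B_G := fun m a b hm hKm ha hab => by
      obtain ⟨h1, h2, h3⟩ := quadricInv_spec (b₀ := p.1) hk.ne' (quad hab)
      simp only [add_sub_cancel_left, h2]
    G_apply := fun q hq => by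
      simp only [mul_div_cancel₀ _ hK.ne, sub_sub_cancel]
      rw [quadricInv_apply hk.ne' hq.2.1 hq.2.2.1.le]
      simp
    G_zero := by
      simp only [mul_zero, sub_zero, quadricInv_self hk.ne', add_zero] }

/-- Polar coordinates in the Minkowski plane. -/
def minkowskiChart (p : ℝ × ℝ) : PolarChart 0 p :=
  have h1 : ∀ q v : ℝ × ℝ, HasDerivAt (fun s : ℝ => q.1 + s * v.1 - p.1) v.1 0 := fun q v =>
    (hasDerivAt_add_mul _ _).sub_const _
  have h2 : ∀ q v : ℝ × ℝ, HasDerivAt (fun s : ℝ => q.2 + s * v.2 - p.2) v.2 0 := fun q v =>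
    (hasDerivAt_add_mul _ _).sub_const _
  have dh : ContDiff ℝ 1 fun q : ℝ × ℝ => ((q.1 - p.1) ^ 2 - (q.2 - p.2) ^ 2) / 2 := by fun_prop
  have fh : ∀ q v : ℝ × ℝ,
      fderiv ℝ (fun q : ℝ × ℝ => ((q.1 - p.1) ^ 2 - (q.2 - p.2) ^ 2) / 2) q v =
      (q.1 - p.1) * v.1 - (q.2 - p.2) * v.2 := fun q v =>
    fderiv_eq_of_hasDerivAt (dh.differentiable one_ne_zero q)
      (((((h1 q v).pow 2).sub ((h2 q v).pow 2)).div_const 2).congr_deriv (by simp; ring))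
  have fA : ∀ q v : ℝ × ℝ, fderiv ℝ (fun q : ℝ × ℝ => q.1 - p.1) q v = v.1 := fun q v =>
    fderiv_eq_of_hasDerivAt (by fun_prop) (h1 q v)
  have fB : ∀ q v : ℝ × ℝ, fderiv ℝ (fun q : ℝ × ℝ => q.2 - p.2) q v = v.2 := fun q v =>
    fderiv_eq_of_hasDerivAt (by fun_prop) (h2 q v)
  { U := {q | 0 < q.1 - p.1 ∧ 0 < ((q.1 - p.1) ^ 2 - (q.2 - p.2) ^ 2) / 2}
    h := fun q => ((q.1 - p.1) ^ 2 - (q.2 - p.2) ^ 2) / 2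
    A := fun q => q.1 - p.1
    B := fun q => q.2 - p.2
    G := fun z => (p.1 + z.2.1, p.2 + z.2.2)
    isOpen_U := (isOpen_lt (by fun_prop) (by fun_prop)).and
      (isOpen_lt (by fun_prop) (by fun_prop))
    contDiff_h := dh
    contDiff_A := by fun_prop
    contDiff_B := by fun_prop
    rel := fun q => by ring
    metric_mul := fun q v => by
      rw [fh, fA, fB, metric]
      simp
      ring
    A_pos := fun q hq => hq.1
    h_pos := fun q hq => hq.2
    mul_h_lt := fun q hq => by simp
    fderiv_h_pos := fun q hq => by
      rw [fh]
      simpa using hq.1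
    mem_of_closure := fun q hq h1 h2 => by
      have hcl : q ∈ {q : ℝ × ℝ | 0 ≤ q.1 - p.1} :=
        closure_minimal (fun z hz => hz.1.le) (isClosed_le (by fun_prop) (by fun_prop)) hq
      refine ⟨lt_of_le_of_ne hcl fun h => ?_, h1⟩
      rw [← h] at h1
      nlinarith [sq_nonneg (q.2 - p.2)]
    eventually_mem := Eventually.of_forall fun q h1 h2 => ⟨by linarith, h2⟩
    h_self := by simp
    A_self := by simp
    B_self := by simp
    metric_self := fun v w => by
      simp only [fA, fB, metric]
      simp
    fderiv_A_pos := fun v hv => by simpa only [fA] using hv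
    contDiffAt_G := fun m a b hm hKm ha hab => by fun_prop
    G_mem := fun m a b hm hKm ha hab => by
      simp only [Set.mem_ofPred_eq, add_sub_cancel_left, hab]
      exact ⟨ha, by linarith⟩
    h_G := fun m a b hm hKm ha hab => by
      simp only [add_sub_cancel_left, hab]
      ring
    A_G := fun m a b hm hKm ha hab => by simp
    B_G := fun m a b hm hKm ha hab => by simp
    G_apply := fun q hq => by simp
    G_zero := by simp }

lemma nonempty_polarChart (K : ℝ) (p : ℝ × ℝ) : Nonempty (PolarChart K p) := by
  rcases lt_trichotomy K 0 with h | rfl | h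
  · exact ⟨deSitterChart h p⟩
  · exact ⟨minkowskiChart p⟩
  · exact ⟨adsChart h p⟩

/-! ### Pieces of curves -/

/-- `γ` is `C¹` on `[a, b]` with tangent vectors satisfying `C`. -/
def IsPiece (C : ℝ × ℝ → ℝ × ℝ → Prop) (γ : ℝ → ℝ × ℝ) (a b : ℝ) : Prop :=
  ContDiffOn ℝ 1 γ (Set.Icc a b) ∧
    ∀ s ∈ Set.Icc a b, C (γ s) (derivWithin γ (Set.Icc a b) s)

namespace IsPiece
variable {C C' : ℝ × ℝ → ℝ × ℝ → Prop} {γ γ' : ℝ → ℝ × ℝ} {a b a' b' : ℝ}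

lemma hasDerivWithinAt (h : IsPiece C γ a b) {s : ℝ} (hs : s ∈ Set.Icc a b) :
    HasDerivWithinAt γ (derivWithin γ (Set.Icc a b) s) (Set.Icc a b) s :=
  (h.1.differentiableOn one_ne_zero s hs).hasDerivWithinAt

/-- On a nondegenerate interval one-sided derivatives are unique, so any derivative may replace
`derivWithin`; on a one-point interval this would fail. -/
lemma of_hasDerivWithinAt (hab : a < b) (h1 : ContDiffOn ℝ 1 γ (Set.Icc a b))
    (h2 : ∀ s ∈ Set.Icc a b, ∃ v, HasDerivWithinAt γ v (Set.Icc a b) s ∧ C (γ s) v) :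
    IsPiece C γ a b := by
  refine ⟨h1, fun s hs => ?_⟩
  obtain ⟨v, hv, hC⟩ := h2 s hs
  rwa [hv.derivWithin (uniqueDiffOn_Icc hab s hs)]

lemma mono (h : IsPiece C γ a b) (ha : a ≤ a') (hab : a' < b') (hb : b' ≤ b) :
    IsPiece C γ a' b' := by
  have hsub := Set.Icc_subset_Icc ha hb
  exact of_hasDerivWithinAt hab (h.1.mono hsub) fun s hs =>
    ⟨_, (h.hasDerivWithinAt (hsub hs)).mono hsub, h.2 s (hsub hs)⟩

lemma congr (h : IsPiece C γ a b) (hab : a < b) (he : Set.EqOn γ' γ (Set.Icc a b)) :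
    IsPiece C γ' a b :=
  of_hasDerivWithinAt hab (h.1.congr he) fun s hs =>
    ⟨_, (h.hasDerivWithinAt hs).congr he (he hs), by rw [he hs]; exact h.2 s hs⟩

lemma imp (h : IsPiece C γ a b) (hC : ∀ q v, C q v → C' q v) : IsPiece C' γ a b :=
  ⟨h.1, fun s hs => hC _ _ (h.2 s hs)⟩

lemma comp_affine (h : IsPiece C γ a b) {c d : ℝ} (hc : 0 < c)
    (hC : ∀ q v, C q v → C q (c • v)) (hab : a' < b') (ha : c * a' + d = a)
    (hb : c * b' + d = b) : IsPiece C (fun s => γ (c * s + d)) a' b' := by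
  have hmaps : Set.MapsTo (fun s => c * s + d) (Set.Icc a' b') (Set.Icc a b) := fun s hs => by
    have h1 := mul_le_mul_of_nonneg_left hs.1 hc.le
    have h2 := mul_le_mul_of_nonneg_left hs.2 hc.le
    exact ⟨by linarith, by linarith⟩
  refine of_hasDerivWithinAt hab (h.1.comp (f := fun s => c * s + d) (by fun_prop) hmaps)
    fun s hs => ⟨c • derivWithin γ (Set.Icc a b) (c * s + d), ?_, hC _ _ (h.2 _ (hmaps hs))⟩
  have h1 : HasDerivWithinAt (fun s => c * s + d) c (Set.Icc a' b') s := by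
    simpa using (((hasDerivAt_id s).const_mul c).add_const d).hasDerivWithinAt
  exact (h.hasDerivWithinAt (hmaps hs)).scomp s h1 hmaps

lemma comp (h : IsPiece C γ a b) (hab : a < b) {F : ℝ × ℝ → ℝ × ℝ}
    (hF : ∀ s ∈ Set.Icc a b, ContDiffAt ℝ 1 F (γ s))
    (hC : ∀ s ∈ Set.Icc a b, ∀ v, C (γ s) v → C' (F (γ s)) (fderiv ℝ F (γ s) v)) :
    IsPiece C' (F ∘ γ) a b :=
  of_hasDerivWithinAt hab (fun s hs => (hF s hs).comp_contDiffWithinAt s (h.1 s hs)) fun s hs =>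
    ⟨_, ((hF s hs).differentiableAt one_ne_zero).hasFDerivAt.comp_hasDerivWithinAt s
      (h.hasDerivWithinAt hs), hC s hs _ (h.2 s hs)⟩

lemma hasDerivAt (h : IsPiece C γ a b) {s : ℝ} (hs : s ∈ Set.Ioo a b) :
    HasDerivAt γ (derivWithin γ (Set.Icc a b) s) s :=
  (h.hasDerivWithinAt (Set.Ioo_subset_Icc_self hs)).hasDerivAt (Icc_mem_nhds hs.1 hs.2)

/-- `derivWithin` is continuous up to the endpoints and agrees with `deriv` inside; the endpoints
are negligible. -/
lemma intervalIntegrable (h : IsPiece C γ a b) (hab : a < b) {Φ : (ℝ × ℝ) × (ℝ × ℝ) → ℝ}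
    (hΦ : ∀ s ∈ Set.Icc a b, ∀ v, ContinuousAt Φ (γ s, v)) :
    IntervalIntegrable (fun s => Φ (γ s, deriv γ s)) volume a b := by
  have h1 : ContinuousOn (fun s => Φ (γ s, derivWithin γ (Set.Icc a b) s)) (Set.Icc a b) :=
    fun s hs => ContinuousAt.comp_continuousWithinAt (g := Φ)
      (f := fun s => (γ s, derivWithin γ (Set.Icc a b) s)) (hΦ s hs _)
      ((h.1.continuousOn s hs).prodMk
        (h.1.continuousOn_derivWithin (uniqueDiffOn_Icc hab) le_rfl s hs))
  refine (ContinuousOn.intervalIntegrable_of_Icc hab.le h1).congr_uIoo fun s hs => ?_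
  rw [Set.uIoo_of_le hab.le] at hs
  simp only [(h.hasDerivAt hs).deriv]

end IsPiece

/-! ### Piecewise `C¹` curves -/

section partition
variable {n : ℕ} {τ : ℕ → ℝ}

lemma partition_mono (hτ : ∀ i < n, τ i < τ (i + 1)) {i j : ℕ} (hij : i ≤ j) (hj : j ≤ n) :
    τ i ≤ τ j := by
  induction j, hij using Nat.le_induction with
  | base => exact le_rfl
  | succ j hij ih => exact (ih (by omega)).trans (hτ j (by omega)).le

lemma exists_mem_Ico_partition {s : ℝ} (h0 : τ 0 ≤ s) (h1 : s < τ n) :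
    ∃ i < n, s ∈ Set.Ico (τ i) (τ (i + 1)) := by
  induction n with
  | zero => exact absurd h1 (not_lt.2 h0)
  | succ n ih =>
    rcases lt_or_ge s (τ n) with h | h
    · obtain ⟨i, hi, hs⟩ := ih h
      exact ⟨i, by omega, hs⟩
    · exact ⟨n, by omega, h, h1⟩

end partition

namespace IsCurveOfType
variable {C C' : ℝ × ℝ → ℝ × ℝ → Prop} {γ : ℝ → ℝ × ℝ} {x y z : ℝ × ℝ}

lemma of_isPiece (h : IsPiece C γ 0 1) : IsCurveOfType C (γ 0) (γ 1) γ := by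
  refine ⟨rfl, rfl, 1, fun i => i, by simp, by simp, fun i _ => by simp, fun i hi => ?_⟩
  obtain rfl : i = 0 := by omega
  change IsPiece C γ _ _
  simpa using h

lemma imp (h : IsCurveOfType C x y γ) (hC : ∀ q v, C q v → C' q v) :
    IsCurveOfType C' x y γ := by
  obtain ⟨h0, h1, n, τ, hτ0, hτn, hτ, hp⟩ := h
  exact ⟨h0, h1, n, τ, hτ0, hτn, hτ, fun i hi => IsPiece.imp (hp i hi) hC⟩

lemma continuousOn (h : IsCurveOfType C x y γ) : ContinuousOn γ (Set.Icc 0 1) := by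
  obtain ⟨h0, h1, n, τ, hτ0, hτn, hτ, hp⟩ := h
  have key : ∀ i ≤ n, ContinuousOn γ (Set.Icc (τ 0) (τ i)) := by
    intro i hi
    induction i with
    | zero => simp
    | succ i ih =>
      rw [← Set.Icc_union_Icc_eq_Icc (partition_mono hτ (Nat.zero_le i) (by omega))
        (hτ i (by omega)).le]
      exact (ih (by omega)).union_of_isClosed (hp i (by omega)).1.continuousOn isClosed_Icc
        isClosed_Icc
  have := key n le_rfl
  rwa [hτ0, hτn] at this

/-- Right derivatives exist even at break points, which allows monotonicity to be proved without
splitting the curve. -/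
lemma exists_hasDerivWithinAt_Ici (h : IsCurveOfType C x y γ) {s : ℝ} (hs : s ∈ Set.Ico (0 : ℝ) 1) :
    ∃ v, HasDerivWithinAt γ v (Set.Ici s) s ∧ C (γ s) v := by
  obtain ⟨h0, h1, n, τ, hτ0, hτn, hτ, hp⟩ := h
  obtain ⟨i, hi, hsi⟩ := exists_mem_Ico_partition (τ := τ) (n := n) (s := s)
    (by rw [hτ0]; exact hs.1) (by rw [hτn]; exact hs.2)
  refine ⟨_, ?_, (hp i hi).2 s ⟨hsi.1, hsi.2.le⟩⟩
  have h2 := (IsPiece.hasDerivWithinAt (hp i hi) ⟨hsi.1, hsi.2.le⟩).mono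
    (Set.Icc_subset_Icc_left hsi.1)
  exact h2.mono_of_mem_nhdsWithin (Icc_mem_nhdsGE hsi.2)

lemma exists_hasDerivAt (h : IsCurveOfType C x y γ) :
    ∃ S : Set ℝ, S.Countable ∧ ∀ s ∈ Set.Ioo (0 : ℝ) 1 \ S,
      HasDerivAt γ (deriv γ s) s ∧ C (γ s) (deriv γ s) := by
  obtain ⟨h0, h1, n, τ, hτ0, hτn, hτ, hp⟩ := h
  refine ⟨Set.range τ, Set.countable_range τ, fun s hs => ?_⟩
  obtain ⟨i, hi, hsi⟩ := exists_mem_Ico_partition (τ := τ) (n := n) (s := s)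
    (by rw [hτ0]; exact hs.1.1.le) (by rw [hτn]; exact hs.1.2)
  have hsi' : s ∈ Set.Ioo (τ i) (τ (i + 1)) :=
    ⟨lt_of_le_of_ne hsi.1 fun he => hs.2 ⟨i, he⟩, hsi.2⟩
  have h2 := IsPiece.hasDerivAt (hp i hi) hsi'
  rw [h2.deriv]
  exact ⟨h2, (hp i hi).2 s (Set.Ioo_subset_Icc_self hsi')⟩

lemma intervalIntegrable (h : IsCurveOfType C x y γ) {Φ : (ℝ × ℝ) × (ℝ × ℝ) → ℝ}
    (hΦ : ∀ s ∈ Set.Icc (0 : ℝ) 1, ∀ v, ContinuousAt Φ (γ s, v)) :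
    IntervalIntegrable (fun s => Φ (γ s, deriv γ s)) volume 0 1 := by
  obtain ⟨h0, h1, n, τ, hτ0, hτn, hτ, hp⟩ := h
  rw [← hτ0, ← hτn]
  refine IntervalIntegrable.trans_iterate fun i hi => IsPiece.intervalIntegrable (hp i hi) (hτ i hi)
    fun s hs v => hΦ s ⟨?_, ?_⟩ v
  · rw [← hτ0]; exact (partition_mono hτ (Nat.zero_le i) hi.le).trans hs.1
  · rw [← hτn]; exact hs.2.trans (partition_mono hτ hi le_rfl)

lemma comp (h : IsCurveOfType C x y γ) {F : ℝ × ℝ → ℝ × ℝ}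
    (hF : ∀ s ∈ Set.Icc (0 : ℝ) 1, ContDiffAt ℝ 1 F (γ s))
    (hC : ∀ s ∈ Set.Icc (0 : ℝ) 1, ∀ v, C (γ s) v → C' (F (γ s)) (fderiv ℝ F (γ s) v)) :
    IsCurveOfType C' (F x) (F y) (F ∘ γ) := by
  obtain ⟨h0, h1, n, τ, hτ0, hτn, hτ, hp⟩ := h
  refine ⟨by simp [h0], by simp [h1], n, τ, hτ0, hτn, hτ, fun i hi => ?_⟩
  have hsub : ∀ s ∈ Set.Icc (τ i) (τ (i + 1)), s ∈ Set.Icc (0 : ℝ) 1 := fun s hs => by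
    refine ⟨?_, ?_⟩
    · rw [← hτ0]; exact (partition_mono hτ (Nat.zero_le i) hi.le).trans hs.1
    · rw [← hτn]; exact hs.2.trans (partition_mono hτ hi le_rfl)
  exact IsPiece.comp (hp i hi) (hτ i hi) (fun s hs => hF s (hsub s hs))
    fun s hs => hC s (hsub s hs)

/-- Concatenation of curves. -/
def concat (γ₁ γ₂ : ℝ → ℝ × ℝ) (s : ℝ) : ℝ × ℝ :=
  if s ≤ 1 / 2 then γ₁ (2 * s) else γ₂ (2 * s - 1)

lemma isCurveOfType_concat (hC : ∀ q v, ∀ a : ℝ, 0 < a → C q v → C q (a • v))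
    {γ₁ γ₂ : ℝ → ℝ × ℝ} (h₁ : IsCurveOfType C x y γ₁) (h₂ : IsCurveOfType C y z γ₂) :
    IsCurveOfType C x z (concat γ₁ γ₂) := by
  obtain ⟨h0, h1, n, τ, hτ0, hτn, hτ, hp⟩ := h₁
  obtain ⟨h0', h1', m, σ, hσ0, hσm, hσ, hp'⟩ := h₂
  refine ⟨by simp [concat, h0], by norm_num [concat, h1'], n + m,
    fun i => if i ≤ n then τ i / 2 else (σ (i - n) + 1) / 2, by simp [hτ0], ?_, ?_, ?_⟩
  -- The second partition cannot be trivial, since `σ 0 = 0` and `σ m = 1`.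
  · rcases m.eq_zero_or_pos with rfl | hm
    · rw [hσ0] at hσm; norm_num at hσm
    · simp [hm.ne', hσm]
  · intro i hi
    rcases lt_trichotomy i n with h | rfl | h
    · have := hτ i h
      simp only [h.le, if_true, Nat.succ_le_of_lt h]
      linarith
    · have := hσ 0 (by omega)
      simp only [le_refl, if_true, Nat.not_succ_le_self, if_false, Nat.add_sub_cancel_left, hτn]
      simp only [hσ0, zero_add] at this
      linarith
    · have := hσ (i - n) (by omega)
      simp only [h.not_ge, if_false, show ¬ i + 1 ≤ n by omega,
        show i + 1 - n = i - n + 1 by omega]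
      linarith
  · intro i hi
    change IsPiece C (concat γ₁ γ₂) _ _
    have first : ∀ i < n, IsPiece C (concat γ₁ γ₂) (τ i / 2) (τ (i + 1) / 2) := fun i hi => by
      have hlt := hτ i hi
      have hle : τ (i + 1) ≤ 1 := by rw [← hτn]; exact partition_mono hτ hi le_rfl
      refine IsPiece.congr (IsPiece.comp_affine (hp i hi) (c := 2) (d := 0) two_pos
        (fun q v => hC q v 2 two_pos) (by linarith) (by ring) (by ring)) (by linarith) ?_
      intro s hs
      have : s ≤ 1 / 2 := by linarith [hs.2]
      simp only [concat, this, if_true, add_zero]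
    have second : ∀ i < m, IsPiece C (concat γ₁ γ₂) ((σ i + 1) / 2) ((σ (i + 1) + 1) / 2) :=
      fun i hi => by
      have hlt := hσ i hi
      have hle : 0 ≤ σ i := by rw [← hσ0]; exact partition_mono hσ (Nat.zero_le i) hi.le
      refine IsPiece.congr (IsPiece.comp_affine (hp' i hi) (c := 2) (d := -1) two_pos
        (fun q v => hC q v 2 two_pos) (by linarith) (by ring) (by ring)) (by linarith) ?_
      intro s hs
      simp only [concat]
      split_ifs with h
      · have : s = 1 / 2 := le_antisymm h (by linarith [hs.1])
        subst this
        norm_num [h1, h0']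
      · rfl
    rcases lt_trichotomy i n with h | rfl | h
    · simpa [h.le, Nat.succ_le_of_lt h] using first i h
    · have := second 0 (by omega)
      simp only [le_refl, if_true, Nat.not_succ_le_self, if_false, Nat.add_sub_cancel_left, hτn]
      simpa [hσ0] using this
    · have := second (i - n) (by omega)
      simp only [h.not_ge, if_false, show ¬ i + 1 ≤ n by omega,
        show i + 1 - n = i - n + 1 by omega]
      exact this

/-- Along a piecewise `C¹` curve, a function with nonnegative derivative is monotone. -/
lemma monotoneOn (h : IsCurveOfType C x y γ) {f : ℝ × ℝ → ℝ} {a b : ℝ} (ha : 0 ≤ a) (hb : b ≤ 1)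
    (hf : ∀ s ∈ Set.Icc a b, ContinuousAt f (γ s))
    (hd : ∀ s ∈ Set.Ico a b, DifferentiableAt ℝ f (γ s))
    (hpos : ∀ s ∈ Set.Ico a b, ∀ v, C (γ s) v → 0 ≤ fderiv ℝ f (γ s) v) :
    MonotoneOn (f ∘ γ) (Set.Icc a b) := by
  intro s hs t ht hst
  have hsub : Set.Icc s t ⊆ Set.Icc 0 1 := Set.Icc_subset_Icc (ha.trans hs.1) (ht.2.trans hb)
  have hex : ∀ u ∈ Set.Ico s t, ∃ v, HasDerivWithinAt γ v (Set.Ici u) u ∧ C (γ u) v :=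
    fun u hu => h.exists_hasDerivWithinAt_Ici
      ⟨ha.trans (hs.1.trans hu.1), hu.2.trans_le (ht.2.trans hb)⟩
  choose! v hv hCv using hex
  have hmem : ∀ u ∈ Set.Ico s t, u ∈ Set.Ico a b := fun u hu =>
    ⟨hs.1.trans hu.1, hu.2.trans_le ht.2⟩
  -- The one-sided mean value inequality, for `-(f ∘ γ)` against a constant.
  have key := image_le_of_deriv_right_le_deriv_boundary (f := fun u => -(f (γ u)))
    (f' := fun u => -(fderiv ℝ f (γ u) (v u))) (a := s) (b := t) (B := fun _ => -(f (γ s)))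
    (B' := fun _ => 0) ?_ ?_ le_rfl continuousOn_const
    (fun u _ => hasDerivWithinAt_const u _ _) ?_ (Set.right_mem_Icc.2 hst)
  · simpa using key
  · exact fun u hu => ((hf u ⟨hs.1.trans hu.1, hu.2.trans ht.2⟩).comp_continuousWithinAt
      ((h.continuousOn u (hsub hu)).mono hsub)).neg
  · exact fun u hu => ((hd u (hmem u hu)).hasFDerivAt.comp_hasDerivWithinAt u (hv u hu)).neg
  · exact fun u hu => neg_nonpos.2 (hpos u (hmem u hu) _ (hCv u hu))

end IsCurveOfType

/-! ### Causal curves and their lengths -/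

lemma continuous_metric (K : ℝ) :
    Continuous fun z : (ℝ × ℝ) × (ℝ × ℝ) => metric K z.1 z.2 z.2 := by
  unfold metric; fun_prop

/-- The zero vector counts as causal, so constant curves are causal and `Causal` is reflexive. -/
lemma isFutureCausal_zero (K : ℝ) (p : ℝ × ℝ) : IsFutureCausal K p 0 := by
  simp [IsFutureCausal, IsFuture, metric]

section
variable {K K' : ℝ} {x y z : ℝ × ℝ} {γ γ₁ γ₂ : ℝ → ℝ × ℝ}

lemma IsTimelikeCurve.isCausalCurve (h : IsTimelikeCurve K x y γ) : IsCausalCurve K x y γ :=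
  IsCurveOfType.imp h fun _ _ hv => hv.causal

/-- `hnorm` is defined by cases and need not be continuous, but along a causal curve it equals
`√(g(v, v))` off the countable set of break points. -/
lemma IsCausalCurve.intervalIntegrable_hnorm (h : IsCausalCurve K x y γ) :
    IntervalIntegrable (fun s => hnorm K (γ s) (deriv γ s)) volume 0 1 := by
  have h1 := IsCurveOfType.intervalIntegrable h (Φ := fun z => √(metric K z.1 z.2 z.2))
    fun s _ v => ((continuous_metric K).sqrt).continuousAt
  obtain ⟨S, hS, hd⟩ := IsCurveOfType.exists_hasDerivAt h
  refine h1.congr_ae ?_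
  rw [Set.uIoc_of_le zero_le_one, ← restrict_Ioo_eq_restrict_Ioc]
  filter_upwards [ae_restrict_mem measurableSet_Ioo, ae_restrict_of_ae (hS.ae_notMem volume)]
    with s hs hsS
  exact ((hd s ⟨hs, hsS⟩).2.hnorm_eq).symm

lemma length_nonneg (K : ℝ) (γ : ℝ → ℝ × ℝ) : 0 ≤ length K γ :=
  intervalIntegral.integral_nonneg zero_le_one fun _ _ => hnorm_nonneg _ _ _

lemma IsCausalCurve.le_ell (h : IsCausalCurve K x y γ) :
    ENNReal.ofReal (length K γ) ≤ ell K x y :=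
  le_iSup₂ (f := fun γ (_ : IsCausalCurve K x y γ) => ENNReal.ofReal (length K γ)) γ h

lemma IsCausalCurve.concat (h₁ : IsCausalCurve K x y γ₁) (h₂ : IsCausalCurve K y z γ₂) :
    IsCausalCurve K x z (IsCurveOfType.concat γ₁ γ₂) :=
  IsCurveOfType.isCurveOfType_concat (fun _ _ _ ha hv => hv.smul ha.le) h₁ h₂

lemma IsCausalCurve.length_concat (h₁ : IsCausalCurve K x y γ₁) (h₂ : IsCausalCurve K y z γ₂) :
    length K (IsCurveOfType.concat γ₁ γ₂) = length K γ₁ + length K γ₂ := by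
  have hint := (h₁.concat h₂).intervalIntegrable_hnorm
  have e1 : ∫ s in (0 : ℝ)..1 / 2, hnorm K (IsCurveOfType.concat γ₁ γ₂ s)
      (deriv (IsCurveOfType.concat γ₁ γ₂) s) = length K γ₁ := by
    have e : ∫ s in (0 : ℝ)..1 / 2, hnorm K (IsCurveOfType.concat γ₁ γ₂ s)
        (deriv (IsCurveOfType.concat γ₁ γ₂) s) =
        ∫ s in (0 : ℝ)..1 / 2, 2 * hnorm K (γ₁ (2 * s)) (deriv γ₁ (2 * s)) := by
      refine intervalIntegral.integral_congr_Ioo_of_le (by norm_num) fun s hs => ?_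
      have hev : IsCurveOfType.concat γ₁ γ₂ =ᶠ[𝓝 s] fun s => γ₁ (2 * s) := by
        filter_upwards [Iio_mem_nhds hs.2] with u hu
        simp only [IsCurveOfType.concat, if_pos (le_of_lt (Set.mem_Iio.1 hu))]
      simp only [hev.deriv_eq, hev.eq_of_nhds]
      rw [deriv_comp_mul_left, hnorm_smul _ _ _ two_pos]
    rw [e, intervalIntegral.integral_const_mul,
      intervalIntegral.integral_comp_mul_left (fun s => hnorm K (γ₁ s) (deriv γ₁ s)) two_ne_zero]
    simp [length]
  have e2 : ∫ s in (1 / 2 : ℝ)..1, hnorm K (IsCurveOfType.concat γ₁ γ₂ s)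
      (deriv (IsCurveOfType.concat γ₁ γ₂) s) = length K γ₂ := by
    have e : ∫ s in (1 / 2 : ℝ)..1, hnorm K (IsCurveOfType.concat γ₁ γ₂ s)
        (deriv (IsCurveOfType.concat γ₁ γ₂) s) =
        ∫ s in (1 / 2 : ℝ)..1, 2 * hnorm K (γ₂ (2 * s - 1)) (deriv γ₂ (2 * s - 1)) := by
      refine intervalIntegral.integral_congr_Ioo_of_le (by norm_num) fun s hs => ?_
      have hev : IsCurveOfType.concat γ₁ γ₂ =ᶠ[𝓝 s] fun s => γ₂ (2 * s - 1) := by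
        filter_upwards [Ioi_mem_nhds hs.1] with u hu
        simp only [IsCurveOfType.concat, if_neg (not_le.2 (Set.mem_Ioi.1 hu))]
      simp only [hev.deriv_eq, hev.eq_of_nhds]
      have := deriv_comp_mul_left (2 : ℝ) (fun u => γ₂ (u - 1)) s
      rw [this, deriv_comp_sub_const, hnorm_smul _ _ _ two_pos]
    rw [e, intervalIntegral.integral_const_mul, intervalIntegral.integral_comp_mul_sub
      (fun s => hnorm K (γ₂ s) (deriv γ₂ s)) two_ne_zero]
    norm_num [length]
    ring
  rw [length, ← intervalIntegral.integral_add_adjacent_intervals (b := 1 / 2), e1, e2]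
  · exact hint.mono_set (by
      rw [Set.uIcc_of_le (by norm_num), Set.uIcc_of_le (by norm_num)]
      exact Set.Icc_subset_Icc le_rfl (by norm_num))
  · exact hint.mono_set (by
      rw [Set.uIcc_of_le (by norm_num), Set.uIcc_of_le (by norm_num)]
      exact Set.Icc_subset_Icc (by norm_num) le_rfl)

/-- The causal relation. -/
def Causal (K : ℝ) (x y : ℝ × ℝ) : Prop := ∃ γ, IsCausalCurve K x y γ

lemma Chron.causal (h : Chron K x y) : Causal K x y := h.imp fun _ hγ => hγ.isCausalCurve

lemma Causal.trans (h₁ : Causal K x y) (h₂ : Causal K y z) : Causal K x z := by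
  obtain ⟨γ₁, h₁⟩ := h₁
  obtain ⟨γ₂, h₂⟩ := h₂
  exact ⟨_, h₁.concat h₂⟩

lemma Causal.of_isPiece {a b : ℝ} (hab : a ≤ b) (h : a < b → IsPiece (IsFutureCausal K) γ a b) :
    Causal K (γ a) (γ b) := by
  rcases hab.eq_or_lt with rfl | hab
  · refine ⟨fun _ => γ a, IsCurveOfType.of_isPiece (γ := fun _ => γ a) ⟨contDiffOn_const, ?_⟩⟩
    intro s _
    simpa using isFutureCausal_zero K (γ a)
  · have h1 := (h hab).comp_affine (c := b - a) (d := a) (a' := 0) (b' := 1) (sub_pos.2 hab)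
      (fun q v hv => hv.smul (sub_pos.2 hab).le) one_pos (by ring) (by ring)
    have h2 := IsCurveOfType.of_isPiece h1
    simp only [mul_zero, zero_add, mul_one, sub_add_cancel] at h2
    exact ⟨_, h2⟩

/-- The tail of the curve is assembled from the rest of the current piece and the later pieces, by
descending induction over the partition. -/
lemma IsCausalCurve.causal (h : IsCausalCurve K x y γ) {s : ℝ} (hs : s ∈ Set.Icc (0 : ℝ) 1) :
    Causal K (γ s) y := by
  obtain ⟨h0, h1, n, τ, hτ0, hτn, hτ, hp⟩ := h
  have key : ∀ i ≤ n, Causal K (γ (τ i)) y := by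
    intro i hi
    induction hi using Nat.decreasingInduction with
    | self =>
      rw [hτn, h1]
      exact Causal.of_isPiece (γ := fun _ => y) (le_refl (0 : ℝ)) fun h => (lt_irrefl _ h).elim
    | of_succ i hi ih => exact (Causal.of_isPiece (hτ i hi).le fun _ => hp i hi).trans ih
  rcases hs.2.eq_or_lt with rfl | hs1
  · rw [← hτn]; exact key n le_rfl
  obtain ⟨i, hi, hsi⟩ := exists_mem_Ico_partition (τ := τ) (n := n) (s := s)
    (by rw [hτ0]; exact hs.1) (by rw [hτn]; exact hs1)
  refine (Causal.of_isPiece hsi.2.le fun hlt => ?_).trans (key (i + 1) hi)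
  exact IsPiece.mono (hp i hi) hsi.1 hlt le_rfl

/-- Append a fixed curve and discard its nonnegative length; this weak form of the reverse triangle
inequality suffices. -/
lemma ell_le_ell_of_causal (h : Causal K y z) : ell K x y ≤ ell K x z := by
  obtain ⟨γ₂, h₂⟩ := h
  refine iSup₂_le fun γ₁ h₁ => le_trans (ENNReal.ofReal_le_ofReal ?_) (h₁.concat h₂).le_ell
  rw [h₁.length_concat h₂]
  linarith [length_nonneg K γ₂]

lemma ell_le_ell_of_causal_left (h : Causal K x y) :
    ell K y z ≤ ell K x z := by
  obtain ⟨γ₁, h₁⟩ := h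
  refine iSup₂_le fun γ₂ h₂ => le_trans (ENNReal.ofReal_le_ofReal ?_) (h₁.concat h₂).le_ell
  rw [h₁.length_concat h₂]
  linarith [length_nonneg K γ₁]

/-- The effect on lengths of a map that sends causal curves to causal curves, provided the norms of
tangent vectors increase at least by the derivative of `Ψ`. -/
lemma IsCausalCurve.length_add_le (h : IsCausalCurve K x y γ) {V : Set (ℝ × ℝ)}
    (hV : ∀ s ∈ Set.Icc (0 : ℝ) 1, γ s ∈ V) {F : ℝ × ℝ → ℝ × ℝ} {Ψ : ℝ × ℝ → ℝ}
    (hF : ∀ q ∈ V, ContDiffAt ℝ 1 F q) (hΨ : ∀ q ∈ V, ContDiffAt ℝ 1 Ψ q)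
    (hc : ∀ q ∈ V, ∀ v, IsFutureCausal K q v → IsFutureCausal K' (F q) (fderiv ℝ F q v))
    (hn : ∀ q ∈ V, ∀ v, IsFutureCausal K q v →
      hnorm K q v + fderiv ℝ Ψ q v ≤ hnorm K' (F q) (fderiv ℝ F q v)) :
    IsCausalCurve K' (F x) (F y) (F ∘ γ) ∧
      length K γ + (Ψ y - Ψ x) ≤ length K' (F ∘ γ) := by
  have hFγ : IsCausalCurve K' (F x) (F y) (F ∘ γ) :=
    IsCurveOfType.comp h (fun s hs => hF _ (hV s hs)) fun s hs => hc _ (hV s hs)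
  refine ⟨hFγ, ?_⟩
  obtain ⟨S, hS, hd⟩ := IsCurveOfType.exists_hasDerivAt h
  have hint := IsCurveOfType.intervalIntegrable h (Φ := fun z => fderiv ℝ Ψ z.1 z.2)
    fun s hs v => by
      have h1 : ContinuousAt (fderiv ℝ Ψ) (γ s) :=
        ((hΨ _ (hV s hs)).fderiv_right (m := 0) (by norm_num)).continuousAt
      exact ContinuousAt.clm_apply (f := fun z : (ℝ × ℝ) × (ℝ × ℝ) => fderiv ℝ Ψ z.1)
        (g := fun z => z.2) (ContinuousAt.comp (f := Prod.fst) h1 continuousAt_fst)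
        continuousAt_snd
  -- The fundamental theorem of calculus across the countably many break points makes the gain
  -- depend on the endpoints only.
  have hftc : ∫ s in (0 : ℝ)..1, fderiv ℝ Ψ (γ s) (deriv γ s) = Ψ y - Ψ x := by
    have := integral_eq_of_hasDerivAt_off_countable_of_le (Ψ ∘ γ)
      (fun s => fderiv ℝ Ψ (γ s) (deriv γ s)) zero_le_one hS
      (fun s hs => (hΨ _ (hV s hs)).continuousAt.comp_continuousWithinAt
        (IsCurveOfType.continuousOn h s hs))
      (fun s hs => ((hΨ _ (hV s (Set.Ioo_subset_Icc_self hs.1))).differentiableAt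
        one_ne_zero).hasFDerivAt.comp_hasDerivAt s (hd s hs).1) hint
    rw [this, Function.comp_apply, Function.comp_apply, h.1, h.2.1]
  rw [← hftc, length, length, ← intervalIntegral.integral_add h.intervalIntegrable_hnorm hint]
  refine intervalIntegral.integral_mono_ae_restrict zero_le_one
    (h.intervalIntegrable_hnorm.add hint) hFγ.intervalIntegrable_hnorm ?_
  rw [← restrict_Ioo_eq_restrict_Icc]
  filter_upwards [ae_restrict_mem measurableSet_Ioo, ae_restrict_of_ae (hS.ae_notMem volume)]
    with s hs hsS
  obtain ⟨h1, h2⟩ := hd s ⟨hs, hsS⟩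
  have hq := hV s (Set.Ioo_subset_Icc_self hs)
  have h3 := ((hF _ hq).differentiableAt one_ne_zero).hasFDerivAt.comp_hasDerivAt s h1
  rw [h3.deriv]
  exact hn _ hq _ h2

end

/-! ### Radial distance and time separation -/

namespace PolarChart
variable {K : ℝ} {p x y q v : ℝ × ℝ} {γ : ℝ → ℝ × ℝ} (c : PolarChart K p)

/-- The radial curve from `p` to `q` has length `R q`. -/
lemma ofReal_R_le_ell (hq : q ∈ c.U) : ENNReal.ofReal (c.R q) ≤ ell K p q := by
  set r := c.R q with hr
  set θ := c.Θ q with hθ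
  have hr0 : 0 < r := c.R_pos hq
  have hrD : BelowDiam K r := c.belowDiam_R hq
  have hs0 : ∀ s ∈ Set.Icc (0 : ℝ) 1, 0 ≤ s * r := fun s hs => mul_nonneg hs.1 hr0.le
  have hsD : ∀ s ∈ Set.Icc (0 : ℝ) 1, BelowDiam K (s * r) := fun s hs =>
    hrD.mono (mul_le_of_le_one_left hr0.le hs.2)
  set γ : ℝ → ℝ × ℝ := fun s => c.E (s * r, θ) with hγ
  set v : ℝ → ℝ × ℝ := fun s => fderiv ℝ c.E (s * r, θ) (r, 0) with hv
  have hline : ∀ s : ℝ, HasDerivAt (fun s : ℝ => (s * r, θ)) (r, 0) s := fun s => by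
    simpa using ((hasDerivAt_id s).mul_const r).prodMk (hasDerivAt_const s θ)
  have hd : ∀ s ∈ Set.Icc (0 : ℝ) 1, HasDerivAt γ (v s) s := fun s hs =>
    HasFDerivAt.comp_hasDerivAt (f := fun s : ℝ => (s * r, θ)) s
      ((c.contDiffAt_E (hs0 s hs) (hsD s hs)).differentiableAt one_ne_zero).hasFDerivAt (hline s)
  have hC1 : ContDiffOn ℝ 1 γ (Set.Icc 0 1) := fun s hs =>
    ((c.contDiffAt_E (hs0 s hs) (hsD s hs)).comp s
      (f := fun s : ℝ => (s * r, θ)) (by fun_prop)).contDiffWithinAt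
  have hev : ∀ s ∈ Set.Ioc (0 : ℝ) 1, ∀ᶠ u in 𝓝 s, 0 < u * r ∧ BelowDiam K (u * r) :=
    fun s hs => by
      have h1 : ContinuousAt (fun u => u * r) s := by fun_prop
      exact (h1.eventually_const_lt (mul_pos hs.1 hr0)).and
        (h1.eventually ((isOpen_belowDiam K).mem_nhds (hsD s ⟨hs.1.le, hs.2⟩)))
  have hU : ∀ s ∈ Set.Ioc (0 : ℝ) 1, γ s ∈ c.U := fun s hs =>
    c.E_mem (mul_pos hs.1 hr0) (hsD s ⟨hs.1.le, hs.2⟩)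
  have hR : ∀ s ∈ Set.Ioc (0 : ℝ) 1, fderiv ℝ c.R (γ s) (v s) = r := fun s hs => by
    have h1 := ((c.contDiffAt_R (hU s hs)).differentiableAt
      one_ne_zero).hasFDerivAt.comp_hasDerivAt s (hd s ⟨hs.1.le, hs.2⟩)
    have h2 : c.R ∘ γ =ᶠ[𝓝 s] fun u => u * r := by
      filter_upwards [hev s hs] with u hu using c.R_E hu.1 hu.2
    have h3 : HasDerivAt (fun u => u * r) r s := by
      simpa using (hasDerivAt_id s).mul_const r
    exact (h1.congr_of_eventuallyEq h2.symm).unique h3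
  have hΘ : ∀ s ∈ Set.Ioc (0 : ℝ) 1, fderiv ℝ c.Θ (γ s) (v s) = 0 := fun s hs => by
    have h1 := ((c.contDiffAt_Θ (hU s hs)).differentiableAt
      one_ne_zero).hasFDerivAt.comp_hasDerivAt s (hd s ⟨hs.1.le, hs.2⟩)
    have h2 : c.Θ ∘ γ =ᶠ[𝓝 s] fun _ => θ := by
      filter_upwards [hev s hs] with u hu using c.Θ_E hu.1 hu.2
    exact (h1.congr_of_eventuallyEq h2.symm).unique (hasDerivAt_const s θ)
  have hm : ∀ s ∈ Set.Ioc (0 : ℝ) 1, metric K (γ s) (v s) (v s) = r ^ 2 := fun s hs => by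
    rw [c.metric_eq (hU s hs), hR s hs, hΘ s hs]; ring
  have hcaus : ∀ s ∈ Set.Ioc (0 : ℝ) 1, IsFutureCausal K (γ s) (v s) := fun s hs =>
    c.isFutureCausal_of_fderiv_R (hU s hs) (by rw [hm s hs]; positivity)
      (by rw [hR s hs]; exact hr0.le)
  -- Polar coordinates are unavailable at the vertex; causality is a closed condition and passes to
  -- the limit of the tangents.
  have hcaus0 : IsFutureCausal K (γ 0) (v 0) := by
    have h0 : (0 : ℝ) ∈ Set.Icc (0 : ℝ) 1 := ⟨le_rfl, zero_le_one⟩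
    have hv0 : Tendsto v (𝓝[>] 0) (𝓝 (v 0)) := by
      have h1 : ContinuousAt (fderiv ℝ c.E) (0 * r, θ) :=
        ((c.contDiffAt_E (hs0 0 h0) (hsD 0 h0)).fderiv_right (m := 0) (by norm_num)).continuousAt
      have h2 : ContinuousAt (fun s : ℝ => fderiv ℝ c.E (s * r, θ)) 0 :=
        ContinuousAt.comp (f := fun s : ℝ => (s * r, θ)) h1 (by fun_prop)
      exact (h2.clm_apply continuousAt_const).tendsto.mono_left nhdsWithin_le_nhds
    have hγ0 : Tendsto γ (𝓝[>] 0) (𝓝 (γ 0)) :=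
      (hd 0 h0).continuousAt.tendsto.mono_left nhdsWithin_le_nhds
    have hIoc : ∀ᶠ s in 𝓝[>] (0 : ℝ), s ∈ Set.Ioc (0 : ℝ) 1 := Ioc_mem_nhdsGT one_pos
    refine ⟨?_, isFuture_iff.2 ?_⟩
    · refine ge_of_tendsto (((continuous_metric K).tendsto (γ 0, v 0)).comp
        (hγ0.prodMk_nhds hv0)) ?_
      filter_upwards [hIoc] with s hs using (hcaus s hs).1
    · refine ge_of_tendsto ((continuous_fst.tendsto (v 0)).comp hv0) ?_
      filter_upwards [hIoc] with s hs using isFuture_iff.1 (hcaus s hs).2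
  have hpiece : IsPiece (IsFutureCausal K) γ 0 1 :=
    IsPiece.of_hasDerivWithinAt one_pos hC1 fun s hs =>
      ⟨v s, (hd s hs).hasDerivWithinAt, by
        rcases hs.1.eq_or_lt with rfl | h
        · exact hcaus0
        · exact hcaus s ⟨h, hs.2⟩⟩
  have hcurve : IsCausalCurve K p q γ := by
    have := IsCurveOfType.of_isPiece hpiece
    simp only [hγ, zero_mul, one_mul, c.E_zero] at this
    rwa [hr, hθ, c.E_R_Θ hq] at this
  have hlen : length K γ = r := by
    have : length K γ = ∫ s in (0 : ℝ)..1, r := by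
      refine intervalIntegral.integral_congr_Ioo_of_le zero_le_one fun s hs => ?_
      have hs' := Set.Ioo_subset_Ioc_self hs
      simp only [(hd s (Set.Ioo_subset_Icc_self hs)).deriv]
      rw [(hcaus s hs').hnorm_eq, hm s hs', Real.sqrt_sq hr0.le]
    rw [this]; simp
  rw [← hlen]
  exact hcurve.le_ell

lemma fderiv_h_nonneg (hq : q ∈ c.U) (hv : IsFutureCausal K q v) : 0 ≤ fderiv ℝ c.h q v := by
  rw [← c.sn_mul_fderiv_R hq]
  exact mul_nonneg (c.sn_R_pos hq).le (c.fderiv_R_nonneg hq hv)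

/-- A causal curve that has entered the domain of the polar coordinates stays there as long as the
time separation from `p` is less than `D_K`. -/
lemma mem_of_ell_lt (hγ : IsCausalCurve K x y γ) {s₀ : ℝ} (hs₀ : 0 ≤ s₀) (hmem : γ s₀ ∈ c.U)
    (hell : ell K p y < diam K) : ∀ s ∈ Set.Icc s₀ 1, γ s ∈ c.U := by
  by_contra! hne
  have hcont := IsCurveOfType.continuousOn hγ
  have hsub : Set.Icc s₀ 1 ⊆ Set.Icc 0 1 := Set.Icc_subset_Icc_left hs₀
  set T := Set.Icc s₀ 1 ∩ γ ⁻¹' (c.U)ᶜ with hT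
  have hTc : IsCompact T :=
    isCompact_Icc.of_isClosed_subset ((hcont.mono hsub).preimage_isClosed_of_isClosed isClosed_Icc
      c.isOpen_U.isClosed_compl) Set.inter_subset_left
  have hTne : T.Nonempty := by
    obtain ⟨s, hs, hsU⟩ := hne
    exact ⟨s, hs, hsU⟩
  -- The first exit time.
  obtain ⟨t, ht⟩ : ∃ t, t = sInf T := ⟨_, rfl⟩
  have htT : t ∈ T := ht ▸ hTc.sInf_mem hTne
  have htlt : s₀ < t := by
    refine lt_of_le_of_ne htT.1.1 fun h => htT.2 ?_
    rwa [← h]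
  have hbefore : ∀ u ∈ Set.Ico s₀ t, γ u ∈ c.U := fun u hu => by
    by_contra hu'
    have : sInf T ≤ u := csInf_le hTc.bddBelow ⟨⟨hu.1, hu.2.le.trans htT.1.2⟩, hu'⟩
    linarith [hu.2]
  have hev : ∀ᶠ u in 𝓝[<] t, u ∈ Set.Ico s₀ t := Ico_mem_nhdsLT htlt
  have hlim : Tendsto γ (𝓝[<] t) (𝓝 (γ t)) := by
    have h1 := hcont t (hsub htT.1)
    refine h1.mono_left (nhdsWithin_le_iff.2 ?_)
    filter_upwards [hev] with u hu using hsub ⟨hu.1, hu.2.le.trans htT.1.2⟩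
  have hcl : γ t ∈ closure c.U :=
    mem_closure_of_tendsto hlim (by filter_upwards [hev] with u hu using hbefore u hu)
  have hmono := IsCurveOfType.monotoneOn hγ (f := c.h) hs₀ htT.1.2
    (fun s _ => c.contDiff_h.continuous.continuousAt)
    (fun s _ => c.contDiff_h.differentiable one_ne_zero _)
    fun s hs v hv => c.fderiv_h_nonneg (hbefore s hs) hv
  have hpos : 0 < c.h (γ t) := (c.h_pos _ hmem).trans_le
    (hmono (Set.left_mem_Icc.2 htlt.le) (Set.right_mem_Icc.2 htlt.le) htlt.le)
  -- As `h` has not decreased, it is positive at the exit point; the only way out is therefore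
  -- through `K h ≥ 2`, that is, at radius `D_K`.
  have h2 : 2 ≤ K * c.h (γ t) := by
    by_contra! h
    exact htT.2 (c.mem_of_closure _ hcl hpos h)
  have hD : diam K ≤ ENNReal.ofReal (c.R (γ t)) :=
    not_lt.1 fun h => not_belowDiam_rad hpos h2 (ofReal_lt_diam.1 h)
  -- Before the exit, the radius is bounded by `ℓ(p, γ u) ≤ ℓ(p, y)`; continuity of `R` carries this
  -- bound to the exit point, outside the domain.
  have hle : ENNReal.ofReal (c.R (γ t)) ≤ ell K p y := by
    refine le_of_tendsto
      (((ENNReal.continuous_ofReal.comp c.continuous_R).tendsto (γ t)).comp hlim) ?_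
    filter_upwards [hev] with u hu
    exact (c.ofReal_R_le_ell (hbefore u hu)).trans
      (ell_le_ell_of_causal (hγ.causal (hsub ⟨hu.1, hu.2.le.trans htT.1.2⟩)))
  exact absurd (hD.trans hle) (not_le.2 hell)

/-- The angular coordinate of a tangent vector at `p`. -/
def dir (v : ℝ × ℝ) : ℝ :=
  Real.arsinh (fderiv ℝ c.B p v / √(fderiv ℝ c.A p v ^ 2 - fderiv ℝ c.B p v ^ 2))

lemma fderiv_sq_sub_sq_pos (hv : IsFutureTimelike K p v) :
    0 < fderiv ℝ c.A p v ^ 2 - fderiv ℝ c.B p v ^ 2 := by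
  have h := hv.1
  rw [← c.metric_self] at h
  linarith

lemma hnorm_self (hv : IsFutureTimelike K p v) :
    hnorm K p v = √(fderiv ℝ c.A p v ^ 2 - fderiv ℝ c.B p v ^ 2) := by
  rw [hv.causal.hnorm_eq, ← c.metric_self]
  congr 1
  ring

lemma hnorm_mul_sinh_dir (hv : IsFutureTimelike K p v) :
    hnorm K p v * Real.sinh (c.dir v) = fderiv ℝ c.B p v := by
  rw [c.hnorm_self hv, dir, Real.sinh_arsinh, mul_div_cancel₀]
  exact (Real.sqrt_pos.2 (c.fderiv_sq_sub_sq_pos hv)).ne'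

lemma hnorm_mul_cosh_dir (hv : IsFutureTimelike K p v) :
    hnorm K p v * Real.cosh (c.dir v) = fderiv ℝ c.A p v := by
  have h1 : 0 ≤ hnorm K p v * Real.cosh (c.dir v) :=
    mul_nonneg (hnorm_nonneg _ _ _) (Real.cosh_pos _).le
  rw [← sq_eq_sq₀ h1 (c.fderiv_A_pos v hv.fst_pos).le, mul_pow, Real.cosh_sq, mul_add, ← mul_pow,
    c.hnorm_mul_sinh_dir hv, c.hnorm_self hv, Real.sq_sqrt (c.fderiv_sq_sub_sq_pos hv).le]
  ring

/-- In the orthonormal coframe a future timelike vector is `|v| (cosh, sinh)` of its direction, so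
the normalised product is the hyperbolic cosine of a difference. The absolute value loses the
orientation. -/
lemma vecAngle_eq {w : ℝ × ℝ} (hv : IsFutureTimelike K p v) (hw : IsFutureTimelike K p w) :
    vecAngle K p v w = |c.dir v - c.dir w| := by
  have hpos : ∀ {v}, IsFutureTimelike K p v → 0 < hnorm K p v := fun hv => by
    rw [c.hnorm_self hv]; exact Real.sqrt_pos.2 (c.fderiv_sq_sub_sq_pos hv)
  have h1 := hpos hv
  have h2 := hpos hw
  have h3 : metric K p v w / (hnorm K p v * hnorm K p w) = Real.cosh |c.dir v - c.dir w| := by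
    rw [Real.cosh_abs, Real.cosh_sub, ← c.metric_self, ← c.hnorm_mul_cosh_dir hv,
      ← c.hnorm_mul_cosh_dir hw, ← c.hnorm_mul_sinh_dir hv, ← c.hnorm_mul_sinh_dir hw]
    field_simp
  rw [vecAngle, h3, Real.arcosh_cosh (abs_nonneg _)]

lemma tendsto_div {f : ℝ × ℝ → ℝ} (hf : DifferentiableAt ℝ f p) (hfp : f p = 0) (hγ0 : γ 0 = p)
    (hγ : HasDerivWithinAt γ v (Set.Ici 0) 0) :
    Tendsto (fun s => f (γ s) / s) (𝓝[>] 0) (𝓝 (fderiv ℝ f p v)) := by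
  subst hγ0
  have h1 := (hf.hasFDerivAt.comp_hasDerivWithinAt 0 hγ).Ioi_of_Ici
  rw [hasDerivWithinAt_iff_tendsto_slope' (by simp)] at h1
  refine h1.congr fun s => ?_
  simp [slope, hfp, div_eq_inv_mul]

/-- A timelike curve issuing from `p` enters the domain of the polar coordinates at once, with the
angular coordinate of its initial direction. -/
lemma eventually_mem_and_tendsto (hγ0 : γ 0 = p) (hγ : HasDerivWithinAt γ v (Set.Ici 0) 0)
    (hv : IsFutureTimelike K p v) :
    (∀ᶠ s in 𝓝[>] 0, γ s ∈ c.U) ∧ Tendsto (c.Θ ∘ γ) (𝓝[>] 0) (𝓝 (c.dir v)) := by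
  have hA := tendsto_div (c.contDiff_A.differentiable one_ne_zero p) c.A_self hγ0 hγ
  have hB := tendsto_div (c.contDiff_B.differentiable one_ne_zero p) c.B_self hγ0 hγ
  -- `B / √(A² - B²)` is homogeneous of degree zero, so dividing `A` and `B` by `s` leaves it
  -- unchanged and replaces them by quantities with limits `dA v`, `dB v`.
  have hAB : Tendsto (fun s => (c.A (γ s) / s) ^ 2 - (c.B (γ s) / s) ^ 2) (𝓝[>] 0)
      (𝓝 (fderiv ℝ c.A p v ^ 2 - fderiv ℝ c.B p v ^ 2)) := (hA.pow 2).sub (hB.pow 2)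
  have hpos := c.fderiv_sq_sub_sq_pos hv
  have ht := tendsto_div (f := fun q => q.1 - p.1) (by fun_prop) (sub_self _) hγ0 hγ
  have hft : fderiv ℝ (fun q : ℝ × ℝ => q.1 - p.1) p v = v.1 := by
    rw [fderiv_sub_const, fderiv_fst]; rfl
  rw [hft] at ht
  have hγc : Tendsto γ (𝓝[>] 0) (𝓝 p) := by
    have := hγ.continuousWithinAt.tendsto
    rw [hγ0] at this
    exact this.mono_left (nhdsWithin_mono 0 Set.Ioi_subset_Ici_self)
  have hh : ∀ᶠ q in 𝓝 p, K * c.h q < 2 :=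
    ((continuous_const.mul c.contDiff_h.continuous).tendsto p).eventually_lt_const
      (by simp [c.h_self])
  constructor
  · filter_upwards [hγc.eventually c.eventually_mem, hγc.eventually hh,
      hAB.eventually_const_lt hpos, ht.eventually_const_lt hv.fst_pos, self_mem_nhdsWithin]
      with s h1 h2 h3 h4 h5
    have hs : 0 < s := h5
    refine h1 (by linarith [(div_pos_iff_of_pos_right hs).1 h4]) ?_
    rw [div_pow, div_pow, ← sub_div, c.rel] at h3
    exact pos_of_mul_pos_left ((div_pos_iff_of_pos_right (by positivity)).1 h3) (by linarith)
  · have h1 := (Real.continuous_arsinh.tendsto _).comp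
      (hB.div hAB.sqrt (Real.sqrt_pos.2 hpos).ne')
    refine h1.congr' ?_
    filter_upwards [self_mem_nhdsWithin] with s h5
    have hs : 0 < s := h5
    simp only [Function.comp_apply, Θ]
    congr 1
    rw [Pi.div_apply, div_pow, div_pow, ← sub_div, Real.sqrt_div' _ (by positivity), Real.sqrt_sq hs.le]
    exact div_div_div_cancel_right₀ (ne_of_gt hs) _ _

/-- Maximising geodesics from `p` are radial. -/
lemma of_isMaxGeodesic (hγ : IsMaxGeodesic K p x γ) (hD : ell K p x < diam K) :
    x ∈ c.U ∧ ENNReal.ofReal (c.R x) = ell K p x ∧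
      c.Θ x = c.dir (derivWithin γ (Set.Icc 0 1) 0) := by
  have hpiece : IsPiece (IsFutureTimelike K) γ 0 1 := ⟨hγ.contDiffOn, hγ.timelike⟩
  have hcaus : IsCausalCurve K p x γ := by
    have := (IsCurveOfType.of_isPiece hpiece).imp fun _ _ hv => hv.causal
    rwa [hγ.source, hγ.target] at this
  have h0 : (0 : ℝ) ∈ Set.Icc (0 : ℝ) 1 := ⟨le_rfl, zero_le_one⟩
  have hd0 : HasDerivWithinAt γ (derivWithin γ (Set.Icc 0 1) 0) (Set.Ici 0) 0 :=
    (hpiece.hasDerivWithinAt h0).mono_of_mem_nhdsWithin (Icc_mem_nhdsGE one_pos)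
  have htl0 := hγ.timelike 0 h0
  rw [hγ.source] at htl0
  obtain ⟨henter, hlim⟩ := c.eventually_mem_and_tendsto hγ.source hd0 htl0
  -- The curve is in the domain at some earlier parameter and cannot leave it.
  have hmem : ∀ s ∈ Set.Ioc (0 : ℝ) 1, γ s ∈ c.U := fun s hs => by
    obtain ⟨s₀, h1, h2⟩ := (henter.and (Ioo_mem_nhdsGT hs.1)).exists
    exact c.mem_of_ell_lt hcaus h2.1.le h1 hD s ⟨h2.2.le, hs.2⟩
  have hx : x ∈ c.U := by
    have := hmem 1 ⟨one_pos, le_rfl⟩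
    rwa [hγ.target] at this
  set w := fun s => derivWithin γ (Set.Icc 0 1) s with hw
  have hcausal : ∀ s ∈ Set.Icc (0 : ℝ) 1, IsFutureCausal K (γ s) (w s) := fun s hs =>
    (hγ.timelike s hs).causal
  have hdγ : ∀ s ∈ Set.Ioo (0 : ℝ) 1, HasDerivAt γ (w s) s := fun s hs => hpiece.hasDerivAt hs
  set N := fun s => √(metric K (γ s) (w s) (w s)) with hN
  have hNc : ContinuousOn N (Set.Icc 0 1) :=
    ((continuous_metric K).comp_continuousOn (hγ.contDiffOn.continuousOn.prodMk
      (hγ.contDiffOn.continuousOn_derivWithin (uniqueDiffOn_Icc one_pos) le_rfl))).sqrt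
  have hNle : ∀ s ∈ Set.Ioo (0 : ℝ) 1, N s ≤ fderiv ℝ c.R (γ s) (w s) := fun s hs => by
    have h1 := c.hnorm_le_fderiv_R (hmem s (Set.Ioo_subset_Ioc_self hs))
      (hcausal s (Set.Ioo_subset_Icc_self hs))
    rwa [(hcausal s (Set.Ioo_subset_Icc_self hs)).hnorm_eq] at h1
  have hlen : length K γ = ∫ s in (0 : ℝ)..1, N s := by
    refine intervalIntegral.integral_congr_Ioo_of_le zero_le_one fun s hs => ?_
    simp only [(hdγ s hs).deriv]
    exact (hcausal s (Set.Ioo_subset_Icc_self hs)).hnorm_eq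
  -- Radius minus arc length is nondecreasing because `|v| ≤ dR v`. It starts at `0` and, by
  -- maximality and `R x ≤ ℓ(p, x)`, ends at most at `0`. Hence it vanishes identically, `|v| = dR
  -- v` throughout, and the angular velocity is zero.
  set φ := fun s => c.R (γ s) - ∫ u in (0 : ℝ)..s, N u with hφ
  have hφd : ∀ s ∈ Set.Ioo (0 : ℝ) 1, HasDerivAt φ (fderiv ℝ c.R (γ s) (w s) - N s) s :=
    fun s hs => by
      have hU := hmem s (Set.Ioo_subset_Ioc_self hs)
      refine (((c.contDiffAt_R hU).differentiableAt
        one_ne_zero).hasFDerivAt.comp_hasDerivAt s (hdγ s hs)).sub ?_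
      refine intervalIntegral.integral_hasDerivAt_right ?_ ?_ ?_
      · refine ContinuousOn.intervalIntegrable_of_Icc hs.1.le (hNc.mono ?_)
        exact Set.Icc_subset_Icc_right hs.2.le
      · exact (hNc.mono Set.Ioo_subset_Icc_self).stronglyMeasurableAtFilter isOpen_Ioo s hs
      · exact hNc.continuousAt (Icc_mem_nhds hs.1 hs.2)
  have hφc : ContinuousOn φ (Set.Icc 0 1) := by
    refine (c.continuous_R.comp_continuousOn hγ.contDiffOn.continuousOn).sub ?_
    have := intervalIntegral.continuousOn_primitive_interval (f := N) (a := 0) (b := 1)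
      (μ := volume) (by
        rw [Set.uIcc_of_le zero_le_one]
        exact hNc.integrableOn_compact isCompact_Icc)
    rwa [Set.uIcc_of_le zero_le_one] at this
  have hφm : MonotoneOn φ (Set.Icc 0 1) := by
    refine monotoneOn_of_deriv_nonneg (convex_Icc 0 1) hφc ?_ ?_
    · rw [interior_Icc]
      exact fun s hs => (hφd s hs).differentiableAt.differentiableWithinAt
    · rw [interior_Icc]
      intro s hs
      rw [(hφd s hs).deriv]
      linarith [hNle s hs]
  have hφ0 : φ 0 = 0 := by simp [hφ, hγ.source, c.R_self]
  have hRle : c.R x ≤ length K γ := by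
    have h1 := c.ofReal_R_le_ell hx
    rwa [← hγ.maximising, ENNReal.ofReal_le_ofReal_iff (length_nonneg K γ)] at h1
  have hφ1 : φ 1 ≤ 0 := by
    simp only [hφ, hγ.target]
    rw [← hlen]
    linarith
  have hφz : ∀ s ∈ Set.Icc (0 : ℝ) 1, φ s = 0 := fun s hs =>
    le_antisymm ((hφm hs (Set.right_mem_Icc.2 zero_le_one) hs.2).trans hφ1)
      (hφ0.symm.le.trans (hφm h0 hs hs.1))
  refine ⟨hx, ?_, ?_⟩
  · rw [← hγ.maximising]
    have h1 := hφz 1 (Set.right_mem_Icc.2 zero_le_one)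
    simp only [hφ, hγ.target] at h1
    rw [← hlen] at h1
    rw [sub_eq_zero.1 h1]
  · have hΘz : ∀ s ∈ Set.Ioo (0 : ℝ) 1, fderiv ℝ c.Θ (γ s) (w s) = 0 := fun s hs => by
      have hU := hmem s (Set.Ioo_subset_Ioc_self hs)
      have hev : φ =ᶠ[𝓝 s] fun _ => 0 := by
        filter_upwards [Icc_mem_nhds hs.1 hs.2] with u hu using hφz u hu
      have h1 := ((hφd s hs).congr_of_eventuallyEq hev.symm).unique (hasDerivAt_const s 0)
      have h2 : N s ^ 2 = metric K (γ s) (w s) (w s) :=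
        Real.sq_sqrt (hcausal s (Set.Ioo_subset_Icc_self hs)).1
      rw [← sub_eq_zero.1 h1, c.metric_eq hU] at h2
      have h3 := c.sn_R_pos hU
      by_contra hne
      have : 0 < sn K (c.R (γ s)) ^ 2 * fderiv ℝ c.Θ (γ s) (w s) ^ 2 := by positivity
      linarith
    have hΘd : ∀ s ∈ Set.Ioo (0 : ℝ) 1, HasDerivAt (c.Θ ∘ γ) 0 s := fun s hs => by
      rw [← hΘz s hs]
      exact ((c.contDiffAt_Θ (hmem s (Set.Ioo_subset_Ioc_self hs))).differentiableAt
        one_ne_zero).hasFDerivAt.comp_hasDerivAt s (hdγ s hs)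
    have hΘc : ContinuousOn (c.Θ ∘ γ) (Set.Ioc 0 1) := fun s hs =>
      (c.contDiffAt_Θ (hmem s hs)).continuousAt.comp_continuousWithinAt
        ((hγ.contDiffOn.continuousOn s (Set.Ioc_subset_Icc_self hs)).mono Set.Ioc_subset_Icc_self)
    have hdiff : DifferentiableOn ℝ (c.Θ ∘ γ) (interior (Set.Ioc 0 1)) := by
      rw [interior_Ioc]
      exact fun s hs => (hΘd s hs).differentiableAt.differentiableWithinAt
    have hconst : ∀ s ∈ Set.Ioc (0 : ℝ) 1, (c.Θ ∘ γ) s = c.Θ x := fun s hs => by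
      have h1 : (1 : ℝ) ∈ Set.Ioc (0 : ℝ) 1 := ⟨one_pos, le_rfl⟩
      have hm := monotoneOn_of_deriv_nonneg (convex_Ioc 0 1) hΘc hdiff (by
        rw [interior_Ioc]
        exact fun s hs => (hΘd s hs).deriv.symm.le)
      have ha := antitoneOn_of_deriv_nonpos (convex_Ioc 0 1) hΘc hdiff (by
        rw [interior_Ioc]
        exact fun s hs => (hΘd s hs).deriv.le)
      have := le_antisymm (hm hs h1 hs.2) (ha hs h1 hs.2)
      rwa [Function.comp_apply (x := (1 : ℝ)), hγ.target] at this
    refine tendsto_nhds_unique (tendsto_const_nhds.congr' ?_) hlim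
    filter_upwards [Ioc_mem_nhdsGT one_pos] with s hs using (hconst s hs).symm

end PolarChart

/-! ### The comparison map and the uniform gain -/

namespace PolarChart
variable {K K' : ℝ} {p p' q : ℝ × ℝ} (c : PolarChart K p) (c' : PolarChart K' p')
variable {ε τ : ℝ}

/-- The map that preserves the radial coordinate and acts by an isometry on the angular one. -/
def polarMap (ε τ : ℝ) (q : ℝ × ℝ) : ℝ × ℝ := c'.E (c.R q, ε * c.Θ q + τ)

lemma contDiffAt_polarMap (hq : q ∈ c.U) (hD : BelowDiam K' (c.R q)) :
    ContDiffAt ℝ 1 (c.polarMap c' ε τ) q :=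
  ContDiffAt.comp q (f := fun q => (c.R q, ε * c.Θ q + τ)) (c'.contDiffAt_E (c.R_pos hq).le hD)
    ((c.contDiffAt_R hq).prodMk ((contDiffAt_const.mul (c.contDiffAt_Θ hq)).add contDiffAt_const))

lemma polarMap_mem (hq : q ∈ c.U) (hD : BelowDiam K' (c.R q)) : c.polarMap c' ε τ q ∈ c'.U :=
  c'.E_mem (c.R_pos hq) hD

lemma R_polarMap (hq : q ∈ c.U) (hD : BelowDiam K' (c.R q)) :
    c'.R (c.polarMap c' ε τ q) = c.R q := c'.R_E (c.R_pos hq) hD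

lemma Θ_polarMap (hq : q ∈ c.U) (hD : BelowDiam K' (c.R q)) :
    c'.Θ (c.polarMap c' ε τ q) = ε * c.Θ q + τ := c'.Θ_E (c.R_pos hq) hD

lemma eventually_belowDiam_R (hq : q ∈ c.U) (hD : BelowDiam K' (c.R q)) :
    ∀ᶠ z in 𝓝 q, z ∈ c.U ∧ BelowDiam K' (c.R z) :=
  (c.isOpen_U.eventually_mem hq).and
    (c.continuous_R.continuousAt.eventually ((isOpen_belowDiam K').mem_nhds hD))

lemma fderiv_R_polarMap (hq : q ∈ c.U) (hD : BelowDiam K' (c.R q)) (v : ℝ × ℝ) :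
    fderiv ℝ c'.R (c.polarMap c' ε τ q) (fderiv ℝ (c.polarMap c' ε τ) q v) =
      fderiv ℝ c.R q v := by
  have h1 := ((c'.contDiffAt_R (c.polarMap_mem c' (ε := ε) (τ := τ) hq hD)).differentiableAt
    one_ne_zero).hasFDerivAt.comp q
    ((c.contDiffAt_polarMap c' hq hD).differentiableAt one_ne_zero).hasFDerivAt
  have h2 : c'.R ∘ c.polarMap c' ε τ =ᶠ[𝓝 q] c.R := by
    filter_upwards [c.eventually_belowDiam_R hq hD] with z hz using c.R_polarMap c' hz.1 hz.2
  rw [← h2.fderiv_eq, h1.fderiv]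
  rfl

lemma fderiv_Θ_polarMap (hq : q ∈ c.U) (hD : BelowDiam K' (c.R q)) (v : ℝ × ℝ) :
    fderiv ℝ c'.Θ (c.polarMap c' ε τ q) (fderiv ℝ (c.polarMap c' ε τ) q v) =
      ε * fderiv ℝ c.Θ q v := by
  have h1 := ((c'.contDiffAt_Θ (c.polarMap_mem c' (ε := ε) (τ := τ) hq hD)).differentiableAt
    one_ne_zero).hasFDerivAt.comp q
    ((c.contDiffAt_polarMap c' hq hD).differentiableAt one_ne_zero).hasFDerivAt
  have h2 : c'.Θ ∘ c.polarMap c' ε τ =ᶠ[𝓝 q] fun z => ε * c.Θ z + τ := by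
    filter_upwards [c.eventually_belowDiam_R hq hD] with z hz using c.Θ_polarMap c' hz.1 hz.2
  have h3 : HasFDerivAt (fun z => ε * c.Θ z + τ) (ε • fderiv ℝ c.Θ q) q :=
    ((((c.contDiffAt_Θ hq).differentiableAt one_ne_zero).hasFDerivAt).const_mul ε).add_const τ
  have h4 := h2.fderiv_eq (𝕜 := ℝ)
  rw [h1.fderiv, h3.fderiv] at h4
  exact congrArg (fun L => L v) h4

lemma metric_polarMap (hε : ε ^ 2 = 1) (hq : q ∈ c.U) (hD : BelowDiam K' (c.R q)) (v : ℝ × ℝ) :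
    metric K' (c.polarMap c' ε τ q) (fderiv ℝ (c.polarMap c' ε τ) q v)
        (fderiv ℝ (c.polarMap c' ε τ) q v) =
      metric K q v v + (sn K (c.R q) ^ 2 - sn K' (c.R q) ^ 2) * fderiv ℝ c.Θ q v ^ 2 := by
  rw [c'.metric_eq (c.polarMap_mem c' hq hD), c.fderiv_R_polarMap c' hq hD,
    c.fderiv_Θ_polarMap c' hq hD, c.R_polarMap c' hq hD, c.metric_eq hq]
  linear_combination (-(sn K' (c.R q) ^ 2 * fderiv ℝ c.Θ q v ^ 2)) * hε

lemma isFutureCausal_polarMap (hK : K < K') (hε : ε ^ 2 = 1) (hq : q ∈ c.U)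
    (hD : BelowDiam K' (c.R q)) {v : ℝ × ℝ} (hv : IsFutureCausal K q v) :
    IsFutureCausal K' (c.polarMap c' ε τ q) (fderiv ℝ (c.polarMap c' ε τ) q v) := by
  refine c'.isFutureCausal_of_fderiv_R (c.polarMap_mem c' hq hD) ?_ ?_
  · rw [c.metric_polarMap c' hε hq hD]
    have h1 := pow_le_pow_left₀ (sn_pos (c.R_pos hq) hD).le (sn_lt_sn hK (c.R_pos hq) hD).le 2
    exact add_nonneg hv.1 (mul_nonneg (sub_nonneg.2 h1) (sq_nonneg _))
  · rw [c.fderiv_R_polarMap c' hq hD]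
    exact c.fderiv_R_nonneg hq hv

/-- Let `P`, `Q` be the new and old norms, `a = dR v`, `b = dΘ v`. Then `P² - Q² ≥ m b²` and `P + Q
≤ 2a`, so for `a > 0` the gain is at least `m b² / (2a)`. Since `(b - μ a)² ≥ 0`, this is at least
`m (μ b - μ² a / 2)`, which is linear in `v` and hence integrates to a difference of endpoint
values. -/
lemma hnorm_add_le_hnorm_polarMap (hK : K < K') (hε : ε ^ 2 = 1) (hq : q ∈ c.U)
    (hD : BelowDiam K' (c.R q)) {v : ℝ × ℝ} (hv : IsFutureCausal K q v) {m μ : ℝ} (hm : 0 ≤ m)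
    (hmle : m ≤ sn K (c.R q) ^ 2 - sn K' (c.R q) ^ 2) :
    hnorm K q v + m * (μ * fderiv ℝ c.Θ q v - μ ^ 2 / 2 * fderiv ℝ c.R q v) ≤
      hnorm K' (c.polarMap c' ε τ q) (fderiv ℝ (c.polarMap c' ε τ) q v) := by
  have hv' := c.isFutureCausal_polarMap c' (τ := τ) hK hε hq hD hv
  have ha := c.fderiv_R_nonneg hq hv
  have hQa := c.hnorm_le_fderiv_R hq hv
  have hPa := c'.hnorm_le_fderiv_R (c.polarMap_mem c' hq hD) hv'
  rw [c.fderiv_R_polarMap c' hq hD] at hPa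
  have hQ0 := hnorm_nonneg K q v
  have hP0 := hnorm_nonneg K' (c.polarMap c' ε τ q) (fderiv ℝ (c.polarMap c' ε τ) q v)
  have hQ2 : hnorm K q v ^ 2 = metric K q v v := by rw [hv.hnorm_eq, Real.sq_sqrt hv.1]
  have hP2 : hnorm K' (c.polarMap c' ε τ q) (fderiv ℝ (c.polarMap c' ε τ) q v) ^ 2 =
      metric K q v v + (sn K (c.R q) ^ 2 - sn K' (c.R q) ^ 2) * fderiv ℝ c.Θ q v ^ 2 := by
    rw [hv'.hnorm_eq, Real.sq_sqrt hv'.1, c.metric_polarMap c' hε hq hD]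
  have hmet := c.metric_eq hq v
  have hs := c.sn_R_pos hq
  generalize hnorm K' (c.polarMap c' ε τ q) (fderiv ℝ (c.polarMap c' ε τ) q v) = P at *
  generalize hnorm K q v = Q at *
  generalize fderiv ℝ c.R q v = a at *
  generalize fderiv ℝ c.Θ q v = b at *
  have hPQ : m * b ^ 2 ≤ P ^ 2 - Q ^ 2 := by
    rw [hP2, hQ2, add_sub_cancel_left]
    exact mul_le_mul_of_nonneg_right hmle (sq_nonneg b)
  -- A causal vector with `dR v = 0` has `dΘ v = 0` too, and all terms vanish.
  rcases ha.eq_or_lt with rfl | ha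
  · have hb : b = 0 := by
      by_contra hb
      have : 0 < sn K (c.R q) ^ 2 * b ^ 2 := by positivity
      nlinarith [hv.1]
    subst hb
    linarith [hQa.antisymm hQ0, hPa.antisymm hP0]
  · have h1 : Q ≤ P := by
      by_contra! h
      nlinarith [mul_nonneg hm (sq_nonneg b)]
    have h2 : (P - Q) * (P + Q) ≤ (P - Q) * (2 * a) :=
      mul_le_mul_of_nonneg_left (by linarith) (sub_nonneg.2 h1)
    have h3 : 0 ≤ m * (b - μ * a) ^ 2 := mul_nonneg hm (sq_nonneg _)
    refine le_of_mul_le_mul_right ?_ (show 0 < 2 * a by positivity)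
    nlinarith

lemma fderiv_const_mul_sub (hq : q ∈ c.U) (m μ : ℝ) (v : ℝ × ℝ) :
    fderiv ℝ (fun q => m * (μ * c.Θ q - μ ^ 2 / 2 * c.R q)) q v =
      m * (μ * fderiv ℝ c.Θ q v - μ ^ 2 / 2 * fderiv ℝ c.R q v) := by
  have h1 := ((c.contDiffAt_Θ hq).differentiableAt one_ne_zero).hasFDerivAt
  have h2 := ((c.contDiffAt_R hq).differentiableAt one_ne_zero).hasFDerivAt
  have h3 : fderiv ℝ (fun q => m * (μ * c.Θ q - μ ^ 2 / 2 * c.R q)) q = _ :=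
    (((h1.const_mul μ).sub (h2.const_mul (μ ^ 2 / 2))).const_mul m).fderiv
  rw [h3]
  rfl

/-- Quantitative comparison: the time separation of two points on different radial geodesics
increases strictly under `polarMap`. -/
lemma ell_lt_ell_polarMap (hK : K < K') (hε : ε ^ 2 = 1) {x y : ℝ × ℝ} (hx : x ∈ c.U)
    (hy : y ∈ c.U) (hpx : Causal K p x) (hxy : Causal K x y)
    (hD : ell K p y < diam K) (hD' : BelowDiam K' (c.R y)) (hΘ : c.Θ x ≠ c.Θ y) :
    ell K x y < ell K' (c.polarMap c' ε τ x) (c.polarMap c' ε τ y) := by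
  have hmem : ∀ γ, IsCausalCurve K x y γ → ∀ s ∈ Set.Icc (0 : ℝ) 1, γ s ∈ c.U := fun γ hγ =>
    c.mem_of_ell_lt hγ le_rfl (by rwa [hγ.1]) hD
  have hmono : ∀ γ, IsCausalCurve K x y γ → MonotoneOn (c.R ∘ γ) (Set.Icc 0 1) := fun γ hγ =>
    IsCurveOfType.monotoneOn hγ le_rfl le_rfl (fun s _ => c.continuous_R.continuousAt)
      (fun s hs => (c.contDiffAt_R (hmem γ hγ s (Set.Ico_subset_Icc_self hs))).differentiableAt
        one_ne_zero)
      fun s hs v hv => c.fderiv_R_nonneg (hmem γ hγ s (Set.Ico_subset_Icc_self hs)) hv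
  have hV : ∀ γ, IsCausalCurve K x y γ → ∀ s ∈ Set.Icc (0 : ℝ) 1,
      γ s ∈ {q | q ∈ c.U ∧ c.R q ∈ Set.Icc (c.R x) (c.R y)} := fun γ hγ s hs => by
    refine ⟨hmem γ hγ s hs, ?_, ?_⟩
    · have := hmono γ hγ (Set.left_mem_Icc.2 zero_le_one) hs hs.1
      rwa [Function.comp_apply, hγ.1] at this
    · have := hmono γ hγ hs (Set.right_mem_Icc.2 zero_le_one) hs.2
      rwa [Function.comp_apply (x := (1 : ℝ)), hγ.2.1] at this
  have hrx := c.R_pos hx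
  have hry := c.R_pos hy
  have hle : c.R x ≤ c.R y := by
    obtain ⟨γ, hγ⟩ := hxy
    have := (hV γ hγ 0 (Set.left_mem_Icc.2 zero_le_one)).2.2
    rwa [hγ.1] at this
  obtain ⟨m, hm, hmle⟩ : ∃ m, 0 < m ∧
      ∀ r ∈ Set.Icc (c.R x) (c.R y), m ≤ sn K r ^ 2 - sn K' r ^ 2 := by
    obtain ⟨r₀, hr₀, hmin⟩ := isCompact_Icc.exists_isMinOn (Set.nonempty_Icc.2 hle)
      (f := fun r => sn K r ^ 2 - sn K' r ^ 2)
      (((contDiff_sn K).continuous.pow 2).sub ((contDiff_sn K').continuous.pow 2)).continuousOn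
    refine ⟨_, ?_, fun r hr => hmin hr⟩
    have h0 := hrx.trans_le hr₀.1
    have hD0 := hD'.mono hr₀.2
    exact sub_pos.2 (pow_lt_pow_left₀ (sn_lt_sn hK h0 hD0) (sn_pos h0 hD0).le two_ne_zero)
  -- Any slope near zero with the sign of the angle difference would do. Dividing by `R y`, known to
  -- be positive, avoids asking whether `R x ≠ R y` and still makes `Ψ y - Ψ x` positive.
  set μ := (c.Θ y - c.Θ x) / c.R y with hμ
  set Ψ := fun q => m * (μ * c.Θ q - μ ^ 2 / 2 * c.R q) with hΨ
  have hδ : 0 < Ψ y - Ψ x := by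
    have e : Ψ y - Ψ x =
        m * ((c.Θ y - c.Θ x) ^ 2 * ((c.R y + c.R x) / (2 * c.R y ^ 2))) := by
      simp only [hΨ, hμ]
      field_simp
      ring
    rw [e]
    have : 0 < (c.Θ y - c.Θ x) ^ 2 := sq_pos_of_ne_zero (sub_ne_zero.2 hΘ.symm)
    positivity
  have hgain : ∀ γ, IsCausalCurve K x y γ →
      ENNReal.ofReal (length K γ) + ENNReal.ofReal (Ψ y - Ψ x) ≤
        ell K' (c.polarMap c' ε τ x) (c.polarMap c' ε τ y) := fun γ hγ => by
    have h := hγ.length_add_le (K' := K') (F := c.polarMap c' ε τ) (Ψ := Ψ) (hV γ hγ)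
      (fun q hq => c.contDiffAt_polarMap c' hq.1 (hD'.mono hq.2.2))
      (fun q hq => contDiffAt_const.mul ((contDiffAt_const.mul (c.contDiffAt_Θ hq.1)).sub
        (contDiffAt_const.mul (c.contDiffAt_R hq.1))))
      (fun q hq v hv => c.isFutureCausal_polarMap c' hK hε hq.1 (hD'.mono hq.2.2) hv)
      (fun q hq v hv => by
        rw [c.fderiv_const_mul_sub hq.1]
        exact c.hnorm_add_le_hnorm_polarMap c' hK hε hq.1 (hD'.mono hq.2.2) hv hm.le
          (hmle _ hq.2))
    rw [← ENNReal.ofReal_add (length_nonneg K γ) hδ.le]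
    exact (ENNReal.ofReal_le_ofReal h.2).trans h.1.le_ell
  -- Finiteness is essential: adding a positive gain to `∞` would not be strict.
  have hfin : ell K x y ≠ ⊤ := ((ell_le_ell_of_causal_left hpx).trans_lt (hD.trans_le le_top)).ne
  have hδ' : ENNReal.ofReal (Ψ y - Ψ x) ≠ 0 := by simpa using hδ
  have hsub : ell K x y ≤ ell K' (c.polarMap c' ε τ x) (c.polarMap c' ε τ y)
      - ENNReal.ofReal (Ψ y - Ψ x) :=
    iSup₂_le fun γ hγ => ENNReal.le_sub_of_add_le_right ENNReal.ofReal_ne_top (hgain γ hγ)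
  obtain ⟨γ, hγ⟩ := hxy
  calc ell K x y < ell K x y + ENNReal.ofReal (Ψ y - Ψ x) := ENNReal.lt_add_right hfin hδ'
    _ ≤ _ := add_le_add_left hsub _
    _ = _ := tsub_add_cancel_of_le (le_add_self.trans (hgain γ hγ))

end PolarChart

end
end LorentzModel

open LorentzModel

/-! ### Assembling the comparison -/

theorem proposition4p2 (K K' : ℝ) (hK : K < K')
    (H : LorentzModel.Hinge K)
    (hpx : LorentzModel.Chron K H.p H.x)
    (hxy : LorentzModel.Chron K H.x H.y)
    (hpy : LorentzModel.ell K H.p H.y < LorentzModel.diam K')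
    (hangle : 0 < H.angle)
    (H' : LorentzModel.Hinge K')
    (hcomp : LorentzModel.IsComparisonHinge H H') :
    LorentzModel.ell K H.x H.y < LorentzModel.ell K' H'.x H'.y := by
  obtain ⟨c⟩ := nonempty_polarChart K H.p
  obtain ⟨c'⟩ := nonempty_polarChart K' H'.p
  have hpx' : ell K H.p H.x ≤ ell K H.p H.y := ell_le_ell_of_causal hxy.causal
  -- The separation is the real length of a side, and below `D_{K'}` it is also below `D_K`.
  have hpyK : ell K H.p H.y < diam K := by
    rw [← H.isMaxGeodesic_sideY.maximising] at hpy ⊢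
    exact ofReal_lt_diam.2 ((ofReal_lt_diam.1 hpy).of_le (length_nonneg _ _) hK.le)
  obtain ⟨hx, hRx, hΘx⟩ := c.of_isMaxGeodesic H.isMaxGeodesic_sideX (hpx'.trans_lt hpyK)
  obtain ⟨hy, hRy, hΘy⟩ := c.of_isMaxGeodesic H.isMaxGeodesic_sideY hpyK
  obtain ⟨hx', hRx', hΘx'⟩ := c'.of_isMaxGeodesic H'.isMaxGeodesic_sideX
    (by rw [hcomp.ell_px]; exact hpx'.trans_lt hpy)
  obtain ⟨hy', hRy', hΘy'⟩ := c'.of_isMaxGeodesic H'.isMaxGeodesic_sideY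
    (by rw [hcomp.ell_py]; exact hpy)
  have hRxx : c'.R H'.x = c.R H.x := by
    rw [hcomp.ell_px, ← hRx] at hRx'
    exact (ENNReal.ofReal_eq_ofReal_iff (c'.R_pos hx').le (c.R_pos hx).le).1 hRx'
  have hRyy : c'.R H'.y = c.R H.y := by
    rw [hcomp.ell_py, ← hRy] at hRy'
    exact (ENNReal.ofReal_eq_ofReal_iff (c'.R_pos hy').le (c.R_pos hy).le).1 hRy'
  have hang : H.angle = |c.Θ H.x - c.Θ H.y| := by
    rw [hΘx, hΘy]
    have h0 : (0 : ℝ) ∈ Set.Icc (0 : ℝ) 1 := ⟨le_rfl, zero_le_one⟩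
    have h1 := H.isMaxGeodesic_sideX.timelike 0 h0
    have h2 := H.isMaxGeodesic_sideY.timelike 0 h0
    rw [H.isMaxGeodesic_sideX.source] at h1
    rw [H.isMaxGeodesic_sideY.source] at h2
    exact c.vecAngle_eq h1 h2
  have hang' : H'.angle = |c'.Θ H'.x - c'.Θ H'.y| := by
    rw [hΘx', hΘy']
    have h0 : (0 : ℝ) ∈ Set.Icc (0 : ℝ) 1 := ⟨le_rfl, zero_le_one⟩
    have h1 := H'.isMaxGeodesic_sideX.timelike 0 h0
    have h2 := H'.isMaxGeodesic_sideY.timelike 0 h0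
    rw [H'.isMaxGeodesic_sideX.source] at h1
    rw [H'.isMaxGeodesic_sideY.source] at h2
    exact c'.vecAngle_eq h1 h2
  -- Equal angles fix the difference of angular coordinates up to sign; `ε` absorbs a reflection.
  obtain ⟨ε, hε, hεΘ⟩ : ∃ ε : ℝ, ε ^ 2 = 1 ∧
      c'.Θ H'.x - c'.Θ H'.y = ε * (c.Θ H.x - c.Θ H.y) := by
    have h := hcomp.angle_eq
    rw [hang, hang'] at h
    rcases abs_eq_abs.1 h with h | h
    · exact ⟨1, by norm_num, by rw [h, one_mul]⟩
    · exact ⟨-1, by norm_num, by rw [h, neg_one_mul]⟩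
  have hD' : BelowDiam K' (c.R H.y) := hRyy ▸ c'.belowDiam_R hy'
  -- The translation `τ` is chosen to match the angle of `H'.x`; the angle of `H'.y` then matches by
  -- the choice of `ε`. A positive hinge angle gives distinct angular coordinates.
  have h := c.ell_lt_ell_polarMap c' (τ := c'.Θ H'.x - ε * c.Θ H.x) hK hε hx hy hpx.causal
    hxy.causal hpyK hD' fun he => by simp [hang, he] at hangle
  have e1 : c.polarMap c' ε (c'.Θ H'.x - ε * c.Θ H.x) H.x = H'.x := by
    rw [PolarChart.polarMap, ← hRxx, add_sub_cancel, c'.E_R_Θ hx']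
  have e2 : c.polarMap c' ε (c'.Θ H'.x - ε * c.Θ H.x) H.y = H'.y := by
    rw [PolarChart.polarMap, ← hRyy, show ε * c.Θ H.y + (c'.Θ H'.x - ε * c.Θ H.x) = c'.Θ H'.y by
      linear_combination hεΘ, c'.E_R_Θ hy']
  rwa [e1, e2] at h
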